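/- Let $n\ge 3$, $N\ge 2$, and equip $\mathbb{R}^n$, $\mathbb{R}^N$ and $\mathbb{R}^{N\times n}$ with their Euclidean norms $|\cdot|$. Let $F:\mathbb{R}^n\times\mathbb{R}^{N\times n}\to\mathbb{R}^N$ be a Carathéodory map, i.e. $x\mapsto F(x,P)$ is (Lebesgue) measurable for every $P\in\mathbb{R}^{N\times n}$ and $P\mapsto F(x,P)$ is continuous for a.e. $x\in\mathbb{R}^n$. Suppose that $F(x,0)=0$ for a.e. $x\in\mathbb{R}^n$ and that $F$ is strictly elliptic: there is a linear map $A:\mathbb{R}^{N\times n}\to\mathbb{R}^N$ such that \[ \operatorname*{ess\,sup}_{x\in\mathbb{R}^n}\ \sup_{P,\,Q\in\mathbb{R}^{N\times n},\ Q\ne 0}\ \frac{|F(x,P+Q)-F(x,P)-A Q|}{|Q|}\ <\ \nu(A):=\min_{\eta\in\mathbb{R}^N,\ a\in\mathbb{R}^n,\ |\eta|=|a|=1}|A(\eta\otimes a)|, \] where $(\eta\otimes a)_{\alpha i}=\eta_\alpha a_i$. Let $2^*=\frac{2n}{n-2}$ and let \[ W^{1;2^*,2}(\mathbb{R}^n)^N=\big\{u\in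 L^{2^*}(\mathbb{R}^n)^N : Du\in L^2(\mathbb{R}^n)^{N\times n}\big\}, \] where $Du=(D_iu_\alpha)_{\alpha i}$ is the weak gradient. Then there is a constant $C>0$, depending only on $F$ (in particular not on $f$), such that for every $f\in L^2(\mathbb{R}^n)^N$ the system \[ F(x,Du(x))=f(x)\quad\text{for a.e. }x\in\mathbb{R}^n \] has exactly one solution $u\in W^{1;2^*,2}(\mathbb{R}^n)^N$, and this solution satisfies \[ \|u\|_{L^{2^*}(\mathbb{R}^n)}+\|Du\|_{L^2(\mathbb{R}^n)}\le C\,\|f\|_{L^2(\mathbb{R}^n)} . \] -/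

import Mathlib

open MeasureTheory
open scoped ENNReal ContDiff

noncomputable section

namespace EllipticSystem

/-- `ℝᵐ` with the Euclidean norm and Lebesgue measure. -/
abbrev Vec (m : ℕ) : Type := EuclideanSpace ℝ (Fin m)

/-- `ℝ^{N × n}` with the Euclidean (Frobenius) norm. -/
abbrev Mat (N n : ℕ) : Type := EuclideanSpace ℝ (Fin N × Fin n)

/-- The rank-one matrix `η ⊗ a`, with entries `η_α a_i`. -/
def rankOne {N n : ℕ} (η : Vec N) (a : Vec n) : Mat N n :=
  WithLp.toLp 2 fun p => η p.1 * a p.2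

/-- The ellipticity constant `ν(A)`, the minimum of `|A : η ⊗ a|` over unit vectors `η`, `a`
(an infimum over a nonempty compact set when `N, n ≥ 1`). -/
def ellipticityConst {N n : ℕ} (A : Mat N n →ₗ[ℝ] Vec N) : ℝ :=
  sInf {r : ℝ | ∃ (η : Vec N) (a : Vec n), ‖η‖ = 1 ∧ ‖a‖ = 1 ∧ r = ‖A (rankOne η a)‖}

/-- `F` is a Carathéodory map: (Lebesgue) measurable in `x` for every `P`, and continuous in `P`
for almost every `x`. Being `AEMeasurable` for `volume` is Lebesgue measurability here. -/
structure IsCaratheodory {N n : ℕ} (F : Vec n → Mat N n → Vec N) : Prop where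
  measurable : ∀ P : Mat N n, AEMeasurable (fun x => F x P) volume
  continuous : ∀ᵐ x : Vec n, Continuous (F x)

/-- The essential supremum over `x` of the supremum over `P` and `Q ≠ 0` of
`|F(x, P + Q) - F(x, P) - A : Q| / |Q|`, as an element of `[0, ∞]`. -/
def deviation {N n : ℕ} (F : Vec n → Mat N n → Vec N) (A : Mat N n →ₗ[ℝ] Vec N) : ℝ≥0∞ :=
  essSup (fun x : Vec n => ⨆ (P : Mat N n) (Q : Mat N n) (_ : Q ≠ 0),
    ENNReal.ofReal (‖F x (P + Q) - F x P - A Q‖ / ‖Q‖)) volume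

/-- Strict ellipticity of `F`. -/
def IsStrictlyElliptic {N n : ℕ} (F : Vec n → Mat N n → Vec N) : Prop :=
  ∃ A : Mat N n →ₗ[ℝ] Vec N, deviation F A < ENNReal.ofReal (ellipticityConst A)

/-- `G` is the weak (distributional) gradient of `u`: `G_{αi} = D_i u_α`. -/
structure IsWeakGradient {N n : ℕ} (u : Vec n → Vec N) (G : Vec n → Mat N n) : Prop where
  locallyIntegrable : LocallyIntegrable u volume
  locallyIntegrable_grad : LocallyIntegrable G volume
  integral_eq : ∀ φ : Vec n → ℝ, ContDiff ℝ ∞ φ → HasCompactSupport φ →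
    ∀ (α : Fin N) (i : Fin n),
      ∫ x, u x α * fderiv ℝ φ x (EuclideanSpace.single i 1) = - ∫ x, G x (α, i) * φ x

/-- Weak gradients are unique almost everywhere. -/
theorem IsWeakGradient.unique {N n : ℕ} {u : Vec n → Vec N} {G H : Vec n → Mat N n}
    (hG : IsWeakGradient u G) (hH : IsWeakGradient u H) : G =ᵐ[volume] H := by
  have key : ∀ p : Fin N × Fin n, ∀ᵐ x : Vec n, G x p = H x p := by
    intro p
    have hc : ∀ {K : Vec n → Mat N n}, LocallyIntegrable K volume →
        LocallyIntegrable (fun x => K x p) volume := by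
      intro K hK x
      obtain ⟨s, hs, h⟩ := hK x
      exact ⟨s, hs, (EuclideanSpace.proj (𝕜 := ℝ) p).integrable_comp h⟩
    have := ae_eq_of_integral_contDiff_smul_eq (μ := (volume : Measure (Vec n)))
      (hc hG.locallyIntegrable_grad) (hc hH.locallyIntegrable_grad) (by
        intro φ h1 h2
        have a := hG.integral_eq φ h1 h2 p.1 p.2
        have b := hH.integral_eq φ h1 h2 p.1 p.2
        have c := neg_injective (a.symm.trans b)
        simpa [mul_comm] using c)
    exact this
  filter_upwards [ae_all_iff.2 key] with x hx
  ext p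
  exact hx p

/-- The Sobolev exponent `2* = 2n / (n - 2)` (used for `n ≥ 3`). -/
def sobolevExp (n : ℕ) : ℝ≥0∞ := ENNReal.ofReal (2 * (n : ℝ) / ((n : ℝ) - 2))

/-- The J.L. Lions space `W^{1;2*,2}(ℝⁿ)^N`: the (classes of) maps in `L^{2*}` whose weak gradient
exists and lies in `L²`. -/
def LionsSpace (n N : ℕ) : Type :=
  {u : Lp (Vec N) (sobolevExp n) (volume : Measure (Vec n)) //
    ∃ G : Lp (Mat N n) 2 (volume : Measure (Vec n)), IsWeakGradient u G}

/-- The underlying element of `L^{2*}`. -/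
def LionsSpace.toLp {n N : ℕ} (u : LionsSpace n N) :
    Lp (Vec N) (sobolevExp n) (volume : Measure (Vec n)) :=
  u.1

/-- The weak gradient `Du`, an element of `L²`. -/
def LionsSpace.grad {n N : ℕ} (u : LionsSpace n N) :
    Lp (Mat N n) 2 (volume : Measure (Vec n)) :=
  u.2.choose

theorem LionsSpace.isWeakGradient_grad {n N : ℕ} (u : LionsSpace n N) :
    IsWeakGradient u.toLp u.grad :=
  u.2.choose_spec

/-- `u` solves `F(·, Du) = f` almost everywhere on `ℝⁿ`. -/
def IsSolution {n N : ℕ} (F : Vec n → Mat N n → Vec N)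
    (f : Lp (Vec N) 2 (volume : Measure (Vec n))) (u : LionsSpace n N) : Prop :=
  ∀ᵐ x : Vec n, F x (u.grad x) = f x

end EllipticSystem

end

/-! The nonlinear system is a small Lipschitz perturbation of the constant-coefficient system `A :
Du = f`; the latter is solved by Fourier analysis and the former by Banach's fixed point theorem.

Linear part. A weak gradient `G` in `L²` is curl free, so its Fourier transform at almost every
frequency `ξ` has the form `η ⊗ ξ` with complex `η`. Ellipticity at each frequency and Plancherel
give `ν(A) ‖G‖ ≤ ‖A : G‖` (`IsWeakGradient.ellipticityConst_mul_norm_le`). On the closure of the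
gradients of test functions, `A` is therefore injective with closed range. The range is dense: for
`f` orthogonal to it, the transform of `f` is annihilated by the transpose of `η ↦ A (η ⊗ ξ)`, an
invertible square matrix for `ξ ≠ 0` (`eq_zero_of_integral_inner_rankOne`). This yields a right
inverse `R` of `A` with Lipschitz constant `1 / ν(A)` (`exists_applyL2_eq`).

Nonlinear part. With `κ` the deviation of `F` from `A`, the map `w ↦ f - (F(·, R w) - w)` on `L²` is
Lipschitz with constant `κ / ν(A) < 1`, and its fixed point gives `F(·, R w) = f`. The Sobolev
inequality makes `R w` the gradient of a function in `L^{2*}` (`exists_potential`).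

Uniqueness and the bound use the a priori estimate for arbitrary weak gradients in `L²`, so no
density of test functions in the Lions space is needed. The estimate determines `Du`, and a function
in `L^{2*}` with zero gradient vanishes (`IsWeakGradient.ae_eq_zero`). -/

noncomputable section

namespace EllipticSystem

open Filter Topology FourierTransform

/-! ### Weak divergence identities on the Fourier side. -/

section Fourier

open SchwartzMap LineDeriv

variable {E : Type*} [NormedAddCommGroup E] [InnerProductSpace ℝ E] [FiniteDimensional ℝ E]
  [MeasurableSpace E] [BorelSpace E]

/-- Smooth cutoff functions with bounded gradients exhausting the space. -/
theorem exists_cutoff (E : Type*) [NormedAddCommGroup E] [InnerProductSpace ℝ E]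
    [FiniteDimensional ℝ E] : ∃ (χ : ℕ → E → ℝ) (C : ℝ), 0 ≤ C ∧
    (∀ k, ContDiff ℝ ∞ (χ k)) ∧ (∀ k, HasCompactSupport (χ k)) ∧ (∀ k x, ‖χ k x‖ ≤ 1) ∧
    (∀ k x, ‖fderiv ℝ (χ k) x‖ ≤ C) ∧ (∀ x, ∀ᶠ k in atTop, χ k x = 1) ∧
    (∀ x, Tendsto (fun k => fderiv ℝ (χ k) x) atTop (𝓝 0)) := by
  let b : ContDiffBump (0 : E) := ⟨1, 2, one_pos, one_lt_two⟩
  have hb : ContDiff ℝ ∞ (b : E → ℝ) := b.contDiff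
  obtain ⟨C, hC⟩ := (hb.continuous_fderiv (by simp)).bounded_above_of_compact_support
    (b.hasCompactSupport.fderiv (𝕜 := ℝ))
  have hC0 : 0 ≤ C := (norm_nonneg _).trans (hC 0)
  have hpos : ∀ k : ℕ, (0 : ℝ) < (k : ℝ) + 1 := fun k => by positivity
  let χ : ℕ → E → ℝ := fun k x => b (((k : ℝ) + 1)⁻¹ • x)
  have hd : ∀ k x, fderiv ℝ (χ k) x = ((k : ℝ) + 1)⁻¹ • fderiv ℝ b (((k : ℝ) + 1)⁻¹ • x) := by
    intro k x
    have h1 : HasFDerivAt (χ k) ((fderiv ℝ b (((k : ℝ) + 1)⁻¹ • x)).comp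
        (((k : ℝ) + 1)⁻¹ • ContinuousLinearMap.id ℝ E)) x :=
      ((hb.differentiable (by simp)) _).hasFDerivAt.comp x
        ((hasFDerivAt_id x).const_smul ((k : ℝ) + 1)⁻¹)
    rw [h1.fderiv]
    ext v
    simp
  have hle : ∀ k x, ‖fderiv ℝ (χ k) x‖ ≤ ((k : ℝ) + 1)⁻¹ * C := by
    intro k x
    rw [hd, norm_smul, Real.norm_of_nonneg (inv_nonneg.2 (hpos k).le)]
    exact mul_le_mul_of_nonneg_left (hC _) (inv_nonneg.2 (hpos k).le)
  refine ⟨χ, C, hC0, fun k => hb.comp (contDiff_const_smul _), fun k => ?_, fun k x => ?_,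
    fun k x => ?_, fun x => ?_, fun x => ?_⟩
  · exact b.hasCompactSupport.comp_homeomorph
      (Homeomorph.smulOfNeZero (((k : ℝ) + 1)⁻¹) (inv_ne_zero (hpos k).ne'))
  · rw [Real.norm_of_nonneg b.nonneg]
    exact b.le_one
  · refine (hle k x).trans (mul_le_of_le_one_left hC0 (inv_le_one_of_one_le₀ ?_))
    simp
  · filter_upwards [eventually_ge_atTop ⌈‖x‖⌉₊] with k hk
    apply b.one_of_mem_closedBall
    have h1 : ‖x‖ ≤ k := (Nat.le_ceil _).trans (by exact_mod_cast hk)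
    rw [mem_closedBall_zero_iff, norm_smul, Real.norm_of_nonneg (inv_nonneg.2 (hpos k).le)]
    change _ ≤ (1 : ℝ)
    rw [inv_mul_le_iff₀ (hpos k)]
    linarith
  · refine squeeze_zero_norm (fun k => hle k x) ?_
    have := (tendsto_one_div_add_atTop_nhds_zero_nat (𝕜 := ℝ)).mul_const C
    simpa using this

variable {ι : Type*} [Fintype ι]

/-- A divergence identity against test functions extends to smooth functions in `H¹`. -/
theorem sum_integral_fderiv_eq_zero_of_memLp {m : ι → E}
    {h : ι → Lp ℂ 2 (volume : Measure E)}
    (H : ∀ φ : E → ℝ, ContDiff ℝ ∞ φ → HasCompactSupport φ →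
      ∑ i, ∫ x, ((fderiv ℝ φ x (m i) : ℝ) : ℂ) * h i x = 0)
    {φ : E → ℝ} (hφ : ContDiff ℝ ∞ φ) (hφ2 : MemLp φ 2 volume)
    (hdφ : ∀ i, MemLp (fun x => fderiv ℝ φ x (m i)) 2 volume) :
    ∑ i, ∫ x, ((fderiv ℝ φ x (m i) : ℝ) : ℂ) * h i x = 0 := by
  obtain ⟨χ, C, hC, hs, hcs, h1, hdC, hlim, hdlim⟩ := exists_cutoff E
  have hφd := hφ.differentiable (by simp)
  have key : Tendsto (fun k => ∑ i, ∫ x, ((fderiv ℝ (χ k * φ) x (m i) : ℝ) : ℂ) * h i x) atTop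
      (𝓝 (∑ i, ∫ x, ((fderiv ℝ φ x (m i) : ℝ) : ℂ) * h i x)) := by
    refine tendsto_finsetSum _ fun i _ => ?_
    have hfd : ∀ k x, fderiv ℝ (χ k * φ) x (m i) =
        χ k x * fderiv ℝ φ x (m i) + φ x * fderiv ℝ (χ k) x (m i) := by
      intro k x
      rw [fderiv_mul ((hs k).differentiable (by simp) x) (hφd x)]
      simp
    refine tendsto_integral_of_dominated_convergence
      (fun x => (‖fderiv ℝ φ x (m i)‖ + ‖φ x‖ * (C * ‖m i‖)) * ‖h i x‖) (fun k => ?_) ?_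
      (fun k => ae_of_all _ fun x => ?_) (ae_of_all _ fun x => ?_)
    · refine AEStronglyMeasurable.mul ?_ (Lp.aestronglyMeasurable _)
      have hc : Continuous fun x => fderiv ℝ (χ k * φ) x (m i) :=
        (((hs k).mul hφ).continuous_fderiv (by simp)).clm_apply continuous_const
      exact (Complex.continuous_ofReal.comp hc).aestronglyMeasurable
    · exact MemLp.integrable_mul ((hdφ i).norm.add (hφ2.norm.mul_const _)) (Lp.memLp (h i)).norm
    · rw [norm_mul, Complex.norm_real, hfd]
      gcongr
      refine (norm_add_le _ _).trans (add_le_add ?_ ?_)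
      · rw [norm_mul]
        exact mul_le_of_le_one_left (norm_nonneg _) (h1 k x)
      · rw [norm_mul]
        gcongr
        exact (ContinuousLinearMap.le_opNorm _ _).trans (by gcongr; exact hdC k x)
    · refine Tendsto.mul_const _ ((Complex.continuous_ofReal.tendsto _).comp ?_)
      simp only [hfd]
      have a1 : Tendsto (fun k => χ k x) atTop (𝓝 1) :=
        tendsto_const_nhds.congr' ((hlim x).mono fun k hk => hk.symm)
      have a2 : Tendsto (fun k => fderiv ℝ (χ k) x (m i)) atTop (𝓝 0) := by
        simpa [Function.comp_def] using ((ContinuousLinearMap.apply ℝ ℝ (m i)).continuous.tendsto _).comp (hdlim x)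
      simpa using (a1.mul_const (fderiv ℝ φ x (m i))).add (a2.const_mul (φ x))
  refine tendsto_nhds_unique key ?_
  have : ∀ k, ∑ i, ∫ x, ((fderiv ℝ (χ k * φ) x (m i) : ℝ) : ℂ) * h i x = 0 := fun k =>
    H _ ((hs k).mul hφ) ((hcs k).mul_right)
  simp [this]

/-- A divergence identity against test functions extends to Schwartz functions. -/
theorem sum_integral_lineDerivOp_eq_zero {m : ι → E}
    {h : ι → Lp ℂ 2 (volume : Measure E)}
    (H : ∀ φ : E → ℝ, ContDiff ℝ ∞ φ → HasCompactSupport φ →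
      ∑ i, ∫ x, ((fderiv ℝ φ x (m i) : ℝ) : ℂ) * h i x = 0) (g : 𝓢(E, ℂ)) :
    ∑ i, ∫ x, (∂_{m i} g) x • h i x = 0 := by
  have hg : ContDiff ℝ ∞ g := g.smooth ⊤
  have hgd := hg.differentiable (by simp)
  have hd : ∀ (L : ℂ →L[ℝ] ℝ) x i, fderiv ℝ (fun x => L (g x)) x (m i) = L ((∂_{m i} g) x) := by
    intro L x i
    rw [lineDerivOp_apply_eq_fderiv]
    have : HasFDerivAt (fun x => L (g x)) (L.comp (fderiv ℝ g x)) x :=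
      L.hasFDerivAt.comp x (hgd x).hasFDerivAt
    rw [this.fderiv]
    simp
  -- The hypothesis concerns real test functions only, so it is applied to the real and imaginary
  -- parts of `g` separately.
  have key : ∀ L : ℂ →L[ℝ] ℝ, ∑ i, ∫ x, ((L ((∂_{m i} g) x) : ℝ) : ℂ) * h i x = 0 := by
    intro L
    have := sum_integral_fderiv_eq_zero_of_memLp H (φ := fun x => L (g x)) (L.contDiff.comp hg)
      (L.comp_memLp' (g.memLp 2)) (fun i => by
        simp only [hd]
        exact L.comp_memLp' ((∂_{m i} g).memLp 2))
    simpa only [hd] using this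
  have hint : ∀ (L : ℂ →L[ℝ] ℝ) i,
      Integrable fun x => ((L ((∂_{m i} g) x) : ℝ) : ℂ) * h i x := by
    intro L i
    exact MemLp.integrable_mul ((L.comp_memLp' ((∂_{m i} g).memLp 2)).ofReal) (Lp.memLp (h i))
  have hre := key Complex.reCLM
  have him := key Complex.imCLM
  have : ∀ i, ∫ x, (∂_{m i} g) x • h i x =
      (∫ x, ((Complex.reCLM ((∂_{m i} g) x) : ℝ) : ℂ) * h i x) +
      Complex.I * ∫ x, ((Complex.imCLM ((∂_{m i} g) x) : ℝ) : ℂ) * h i x := by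
    intro i
    rw [← integral_const_mul, ← integral_add (hint _ i) ((hint _ i).const_mul _)]
    congr 1
    ext x
    conv_lhs => rw [← Complex.re_add_im ((∂_{m i} g : 𝓢(E, ℂ)) x)]
    simp only [Complex.reCLM_apply, Complex.imCLM_apply, smul_eq_mul]
    ring
  simp only [this, Finset.sum_add_distrib, ← Finset.mul_sum, hre, him]
  simp

/-- The multiplication formula for the Fourier transform on `L²`. -/
theorem integral_smul_fourier_eq (f : Lp ℂ 2 (volume : Measure E)) (g : 𝓢(E, ℂ)) :
    ∫ x, g x • (𝓕 f : Lp ℂ 2 (volume : Measure E)) x = ∫ x, (𝓕 g) x • f x := by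
  rw [← Lp.toTemperedDistribution_apply, ← Lp.toTemperedDistribution_apply,
    ← Lp.fourier_toTemperedDistribution_eq]
  rfl

/-- If `∑ᵢ ∂_{mᵢ} hᵢ = 0` weakly with `hᵢ ∈ L²`, then `∑ᵢ ⟪ξ, mᵢ⟫ ĥᵢ(ξ) = 0` almost everywhere. -/
theorem ae_sum_inner_mul_fourier_eq_zero {m : ι → E}
    {h : ι → Lp ℂ 2 (volume : Measure E)}
    (H : ∀ φ : E → ℝ, ContDiff ℝ ∞ φ → HasCompactSupport φ →
      ∑ i, ∫ x, ((fderiv ℝ φ x (m i) : ℝ) : ℂ) * h i x = 0) :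
    ∀ᵐ ξ : E, ∑ i, ((inner ℝ ξ (m i) : ℝ) : ℂ) * (𝓕 (h i) : Lp ℂ 2 (volume : Measure E)) ξ = 0 := by
  apply ae_eq_zero_of_integral_contDiff_smul_eq_zero
  · have hli : ∀ i, LocallyIntegrable (fun ξ => ((inner ℝ ξ (m i) : ℝ) : ℂ) *
        (𝓕 (h i) : Lp ℂ 2 (volume : Measure E)) ξ) := by
      intro i
      rw [← locallyIntegrableOn_univ]
      refine LocallyIntegrableOn.continuousOn_mul ?_ (by fun_prop) isOpen_univ.isLocallyClosed
      rw [locallyIntegrableOn_univ]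
      exact (Lp.memLp _).locallyIntegrable one_le_two
    exact locallyIntegrable_finsetSum Finset.univ fun i _ => hli i
  · intro ψ hψ hψc
    have hψ₁ : HasCompactSupport (Complex.ofRealCLM ∘ ψ) := hψc.comp_left rfl
    have hψ₂ : ContDiff ℝ ∞ (Complex.ofRealCLM ∘ ψ) := by fun_prop
    let g : 𝓢(E, ℂ) := hψ₁.toSchwartzMap hψ₂
    have hg : ∀ ξ, g ξ = ((ψ ξ : ℝ) : ℂ) := fun ξ => rfl
    have hm : ∀ i, ∀ ξ, (smulLeftCLM ℂ (inner ℝ · (m i)) g) ξ =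
        ((inner ℝ ξ (m i) : ℝ) : ℂ) * ψ ξ := by
      intro i ξ
      have : (inner ℝ · (m i)).HasTemperateGrowth := ((innerSL ℝ).flip (m i)).hasTemperateGrowth
      rw [smulLeftCLM_apply_apply this, hg]
      simp
    have hint : ∀ i, Integrable fun ξ => (smulLeftCLM ℂ (inner ℝ · (m i)) g) ξ •
        (𝓕 (h i) : Lp ℂ 2 (volume : Measure E)) ξ := fun i =>
      MemLp.integrable_mul ((smulLeftCLM ℂ (inner ℝ · (m i)) g).memLp 2) (Lp.memLp _)
    -- Testing with `𝓕 g` turns `∂_{m i}` into multiplication of `g` by `-2πi ⟪ξ, m i⟫`; the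
    -- multiplication formula then moves `𝓕` onto `h i`.
    have h1 := sum_integral_lineDerivOp_eq_zero H (𝓕 g)
    have h2 : ∀ i, ∫ x, (∂_{m i} (𝓕 g)) x • h i x = -(2 * Real.pi * Complex.I) *
        ∫ ξ, (smulLeftCLM ℂ (inner ℝ · (m i)) g) ξ •
          (𝓕 (h i) : Lp ℂ 2 (volume : Measure E)) ξ := by
      intro i
      rw [lineDerivOp_fourier_eq, ← integral_smul_fourier_eq, ← integral_const_mul]
      congr 1
      ext ξ
      simp [mul_assoc]
    simp only [h2, ← Finset.mul_sum] at h1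
    have h3 := (mul_eq_zero.1 h1).resolve_left (by simp [Real.pi_ne_zero])
    rw [← integral_finsetSum _ fun i _ => hint i] at h3
    rw [← h3]
    congr 1
    ext ξ
    rw [Finset.smul_sum]
    refine Finset.sum_congr rfl fun i _ => ?_
    rw [hm]
    simp only [smul_eq_mul, Complex.real_smul]
    ring

end Fourier

/-! ### Rank-one matrices and pointwise consequences of ellipticity. -/

section Algebra

variable {N n : ℕ}

theorem norm_rankOne (η : Vec N) (a : Vec n) : ‖rankOne η a‖ = ‖η‖ * ‖a‖ := by
  rw [EuclideanSpace.norm_eq, EuclideanSpace.norm_eq, EuclideanSpace.norm_eq,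
    ← Real.sqrt_mul (Finset.sum_nonneg fun _ _ => by positivity)]
  congr 1
  rw [Fintype.sum_prod_type, Finset.sum_mul_sum]
  simp [rankOne, mul_pow]

/-- `η ↦ η ⊗ a` as a linear map. -/
def rankOneLeft (N : ℕ) {n : ℕ} (a : Vec n) : Vec N →ₗ[ℝ] Mat N n where
  toFun η := rankOne η a
  map_add' η η' := by ext p; simp [rankOne, add_mul]
  map_smul' c η := by ext p; simp [rankOne, mul_assoc]

theorem rankOneLeft_apply (a : Vec n) (η : Vec N) : rankOneLeft N a η = rankOne η a := rfl

theorem rankOne_smul_smul (s t : ℝ) (η : Vec N) (a : Vec n) :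
    rankOne (s • η) (t • a) = (s * t) • rankOne η a := by
  ext p
  simp [rankOne]
  ring

theorem ellipticityConst_mul_norm_rankOne_le (A : Mat N n →ₗ[ℝ] Vec N) (η : Vec N) (a : Vec n) :
    ellipticityConst A * ‖rankOne η a‖ ≤ ‖A (rankOne η a)‖ := by
  rw [norm_rankOne]
  by_cases hη : η = 0
  · simp [hη]
  by_cases ha : a = 0
  · simp [ha]
  have h1 : ellipticityConst A ≤ ‖A (rankOne (‖η‖⁻¹ • η) (‖a‖⁻¹ • a))‖ := by
    refine csInf_le ⟨0, ?_⟩ ⟨_, _, norm_smul_inv_norm hη, norm_smul_inv_norm ha, rfl⟩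
    rintro r ⟨η, a, -, -, rfl⟩
    exact norm_nonneg _
  rw [rankOne_smul_smul, map_smul, norm_smul, norm_mul, norm_inv, norm_inv, norm_norm, norm_norm]
    at h1
  have h2 : 0 < ‖η‖ * ‖a‖ := mul_pos (norm_pos_iff.2 hη) (norm_pos_iff.2 ha)
  rw [← mul_inv, inv_mul_eq_div, le_div_iff₀ h2] at h1
  exact h1

/-- A matrix whose rows are all proportional to `a ≠ 0` is a rank-one matrix. -/
theorem exists_eq_rankOne {Q : Mat N n} {a : Vec n} (ha : a ≠ 0)
    (h : ∀ α i j, a j * Q (α, i) = a i * Q (α, j)) : ∃ η : Vec N, Q = rankOne η a := by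
  obtain ⟨j, hj⟩ : ∃ j, a j ≠ 0 := by
    by_contra! hc
    exact ha (PiLp.ext hc)
  refine ⟨WithLp.toLp 2 fun α => Q (α, j) / a j, ?_⟩
  ext ⟨α, i⟩
  simp only [rankOne]
  field_simp
  linarith [h α i j]

theorem linearMap_apply_coord {ι κ : Type*} [Fintype ι] [DecidableEq ι]
    (A : EuclideanSpace ℝ ι →ₗ[ℝ] EuclideanSpace ℝ κ) (Q : EuclideanSpace ℝ ι) (β : κ) :
    A Q β = ∑ p, A (EuclideanSpace.single p 1) β * Q p := by
  have : Q = ∑ p, Q p • EuclideanSpace.single p (1 : ℝ) := by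
    ext i
    simp [Finset.sum_apply, Pi.single_apply]
  conv_lhs => rw [this]
  simp [Finset.sum_apply, mul_comm]

theorem rankOne_single_left (α : Fin N) (a : Vec n) :
    rankOne (EuclideanSpace.single α 1) a = ∑ i, a i • EuclideanSpace.single (α, i) (1 : ℝ) := by
  ext ⟨β, j⟩
  simp only [rankOne, PiLp.single_apply, WithLp.ofLp_sum, Finset.sum_apply, PiLp.smul_apply,
    smul_eq_mul, Prod.mk.injEq, mul_ite, mul_one, mul_zero, ite_mul, one_mul, zero_mul]
  by_cases h : β = α <;> simp [h]

/-- The condition on `z` has real coefficients, so the real and imaginary parts of `z` are each a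
real rank-one matrix in direction `ξ`. As `A` is real too, the two squared inequalities add up to
the complex one. This is the form needed under the Plancherel integral. -/
theorem ellipticityConst_sq_mul_sum_le {A : Mat N n →ₗ[ℝ] Vec N} (hA : 0 ≤ ellipticityConst A)
    {ξ : Vec n} (hξ : ξ ≠ 0) {z : Fin N × Fin n → ℂ}
    (hz : ∀ α i j, (ξ j : ℂ) * z (α, i) = ξ i * z (α, j)) :
    ellipticityConst A ^ 2 * ∑ p, ‖z p‖ ^ 2 ≤
      ∑ β, ‖∑ p, (A (EuclideanSpace.single p 1) β : ℂ) * z p‖ ^ 2 := by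
  have key : ∀ Q : Mat N n, (∀ α i j, ξ j * Q (α, i) = ξ i * Q (α, j)) →
      ellipticityConst A ^ 2 * ∑ p, Q p ^ 2 ≤
        ∑ β, (∑ p, A (EuclideanSpace.single p 1) β * Q p) ^ 2 := by
    intro Q hQ
    obtain ⟨η, rfl⟩ := exists_eq_rankOne hξ hQ
    have h := ellipticityConst_mul_norm_rankOne_le A η ξ
    have h' := pow_le_pow_left₀ (mul_nonneg hA (norm_nonneg _)) h 2
    rw [mul_pow, EuclideanSpace.norm_sq_eq, EuclideanSpace.norm_sq_eq] at h'
    simp only [Real.norm_eq_abs, sq_abs] at h'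
    refine h'.trans_eq (Finset.sum_congr rfl fun β _ => ?_)
    rw [linearMap_apply_coord]
  have h1 := key (WithLp.toLp 2 fun p => (z p).re) fun α i j => by
    simpa using congrArg Complex.re (hz α i j)
  have h2 := key (WithLp.toLp 2 fun p => (z p).im) fun α i j => by
    simpa using congrArg Complex.im (hz α i j)
  have h3 := add_le_add h1 h2
  rw [← mul_add, ← Finset.sum_add_distrib, ← Finset.sum_add_distrib] at h3
  simp only [← Complex.normSq_eq_norm_sq, Complex.normSq_apply, Complex.re_sum, Complex.im_sum,
    Complex.re_ofReal_mul, Complex.im_ofReal_mul]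
  simpa only [sq] using h3

/-- Ellipticity makes `η ↦ A (η ⊗ ξ)` injective; it is an endomorphism of `Vec N`, hence surjective,
and `w` is orthogonal to its range. -/
theorem eq_zero_of_forall_inner_rankOne {A : Mat N n →ₗ[ℝ] Vec N} (hA : 0 < ellipticityConst A)
    {ξ : Vec n} (hξ : ξ ≠ 0) {w : Vec N}
    (hw : ∀ α, inner ℝ w (A (rankOne (EuclideanSpace.single α 1) ξ)) = 0) : w = 0 := by
  let B : Vec N →ₗ[ℝ] Vec N := A ∘ₗ rankOneLeft N ξ
  have hinj : Function.Injective B := by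
    rw [← LinearMap.ker_eq_bot, LinearMap.ker_eq_bot']
    intro η hη
    have h := ellipticityConst_mul_norm_rankOne_le A η ξ
    have h0 : A (rankOne η ξ) = 0 := hη
    rw [h0, norm_zero, norm_rankOne] at h
    by_contra hne
    have : 0 < ellipticityConst A * (‖η‖ * ‖ξ‖) :=
      mul_pos hA (mul_pos (norm_pos_iff.2 hne) (norm_pos_iff.2 hξ))
    linarith
  obtain ⟨η, hη⟩ := LinearMap.surjective_of_injective hinj w
  have hexp : η = ∑ α, η α • EuclideanSpace.single α (1 : ℝ) := by
    ext i
    simp [Finset.sum_apply, Pi.single_apply]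
  have h0 : inner ℝ w (B η) = 0 := by
    rw [hexp, map_sum, inner_sum]
    refine Finset.sum_eq_zero fun α _ => ?_
    rw [map_smul, inner_smul_right]
    simp [B, rankOneLeft_apply, hw α]
  rw [hη] at h0
  exact inner_self_eq_zero.1 h0

end Algebra

/-! ### Plancherel for vector-valued `L²` functions via complex components. -/

section Components

variable {E : Type*} [NormedAddCommGroup E] [InnerProductSpace ℝ E] [FiniteDimensional ℝ E]
  [MeasurableSpace E] [BorelSpace E] {ι κ : Type*} [Fintype ι] [Fintype κ]

/-- A component of a vector-valued `L²` function, as a complex-valued `L²` function. -/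
def complexComponent (i : ι) : Lp (EuclideanSpace ℝ ι) 2 (volume : Measure E) →L[ℝ]
    Lp ℂ 2 (volume : Measure E) :=
  ContinuousLinearMap.compLpL 2 volume (Complex.ofRealCLM.comp (EuclideanSpace.proj i))

theorem coeFn_complexComponent (i : ι) (G : Lp (EuclideanSpace ℝ ι) 2 (volume : Measure E)) :
    ∀ᵐ x, complexComponent i G x = ((G x i : ℝ) : ℂ) := by
  filter_upwards [ContinuousLinearMap.coeFn_compLpL
    (Complex.ofRealCLM.comp (EuclideanSpace.proj i)) G] with x hx
  simpa [complexComponent] using hx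

theorem integral_norm_sq_eq (f : Lp ℂ 2 (volume : Measure E)) : ∫ x, ‖f x‖ ^ 2 = ‖f‖ ^ 2 := by
  have h := L2.inner_def (𝕜 := ℂ) f f
  rw [inner_self_eq_norm_sq_to_K] at h
  simp only [inner_self_eq_norm_sq_to_K] at h
  apply Complex.ofReal_injective
  rw [← integral_complex_ofReal]
  push_cast
  exact h.symm

theorem sum_norm_complexComponent_sq (G : Lp (EuclideanSpace ℝ ι) 2 (volume : Measure E)) :
    ‖G‖ ^ 2 = ∑ i, ‖complexComponent i G‖ ^ 2 := by
  have h := L2.inner_def (𝕜 := ℝ) G G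
  rw [real_inner_self_eq_norm_sq] at h
  rw [h]
  simp only [← integral_norm_sq_eq]
  rw [← integral_finsetSum _ fun i _ => (Lp.memLp (complexComponent i G)).integrable_norm_pow two_ne_zero]
  refine integral_congr_ae ?_
  filter_upwards [ae_all_iff.2 fun i => coeFn_complexComponent i G] with x hx
  rw [real_inner_self_eq_norm_sq, EuclideanSpace.norm_sq_eq]
  simp [hx]

/-- Plancherel's theorem for vector-valued functions, in components. -/
theorem norm_sq_eq_integral_fourier (G : Lp (EuclideanSpace ℝ ι) 2 (volume : Measure E)) :
    ‖G‖ ^ 2 = ∫ ξ, ∑ i, ‖(𝓕 (complexComponent i G) : Lp ℂ 2 (volume : Measure E)) ξ‖ ^ 2 := by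
  rw [integral_finsetSum _ fun i _ => (Lp.memLp _).integrable_norm_pow two_ne_zero,
    sum_norm_complexComponent_sq]
  simp only [integral_norm_sq_eq, Lp.norm_fourier_eq]

/-- Pointwise application of a linear map to `L²` functions. -/
def applyL2 (A : EuclideanSpace ℝ ι →ₗ[ℝ] EuclideanSpace ℝ κ) :
    Lp (EuclideanSpace ℝ ι) 2 (volume : Measure E) →L[ℝ]
      Lp (EuclideanSpace ℝ κ) 2 (volume : Measure E) :=
  ContinuousLinearMap.compLpL 2 volume A.toContinuousLinearMap

theorem coeFn_applyL2 (A : EuclideanSpace ℝ ι →ₗ[ℝ] EuclideanSpace ℝ κ)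
    (G : Lp (EuclideanSpace ℝ ι) 2 (volume : Measure E)) : ∀ᵐ x, applyL2 A G x = A (G x) := by
  filter_upwards [ContinuousLinearMap.coeFn_compLpL A.toContinuousLinearMap G] with x hx
  simpa [applyL2] using hx

theorem complexComponent_applyL2 [DecidableEq ι] (A : EuclideanSpace ℝ ι →ₗ[ℝ] EuclideanSpace ℝ κ)
    (G : Lp (EuclideanSpace ℝ ι) 2 (volume : Measure E)) (β : κ) :
    complexComponent β (applyL2 A G) =
      ∑ p, (A (EuclideanSpace.single p 1) β : ℂ) • complexComponent p G := by
  apply Lp.ext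
  filter_upwards [coeFn_complexComponent β (applyL2 A G), coeFn_applyL2 A G,
    Lp.coeFn_finsetSum Finset.univ fun p => (A (EuclideanSpace.single p 1) β : ℂ) • complexComponent p G,
    ae_all_iff.2 fun p => coeFn_complexComponent p G,
    ae_all_iff.2 fun p => Lp.coeFn_smul (A (EuclideanSpace.single p 1) β : ℂ) (complexComponent p G)]
    with x h1 h2 h3 h4 h5
  rw [h1, h2, h3, linearMap_apply_coord]
  simp only [Finset.sum_apply, h5, Pi.smul_apply, h4, smul_eq_mul]
  push_cast
  rfl

theorem coeFn_fourier_sum_smul (c : ι → ℂ) (f : ι → Lp ℂ 2 (volume : Measure E)) :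
    ∀ᵐ ξ, (𝓕 (∑ p, c p • f p) : Lp ℂ 2 (volume : Measure E)) ξ =
      ∑ p, c p * (𝓕 (f p) : Lp ℂ 2 (volume : Measure E)) ξ := by
  have h : (𝓕 (∑ p, c p • f p) : Lp ℂ 2 (volume : Measure E)) =
      ∑ p, c p • (𝓕 (f p) : Lp ℂ 2 (volume : Measure E)) := by
    change Lp.fourierTransformₗᵢ E ℂ (∑ p, c p • f p) = _
    rw [map_sum]
    simp only [map_smul]
    rfl
  rw [h]
  filter_upwards [Lp.coeFn_finsetSum Finset.univ fun p => c p • (𝓕 (f p) : Lp ℂ 2 (volume : Measure E)),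
    ae_all_iff.2 fun p => Lp.coeFn_smul (c p) (𝓕 (f p) : Lp ℂ 2 (volume : Measure E))] with ξ h1 h2
  rw [h1]
  simp [h2]

end Components

/-! ### The a priori estimate and the adjoint equation for `A : Du`. -/

section Estimate

variable {N n : ℕ}

theorem coordinate_inner_single (ξ : Vec n) (i : Fin n) :
    inner ℝ ξ (EuclideanSpace.single i 1) = ξ i := by
  simp [EuclideanSpace.inner_single_right]

/-- Weak gradients are curl free. -/
theorem IsWeakGradient.integral_symm {u : Vec n → Vec N} {G : Vec n → Mat N n}
    (h : IsWeakGradient u G) {φ : Vec n → ℝ} (hφ : ContDiff ℝ ∞ φ) (hc : HasCompactSupport φ)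
    (α : Fin N) (i j : Fin n) :
    ∫ x, G x (α, i) * fderiv ℝ φ x (EuclideanSpace.single j 1) =
      ∫ x, G x (α, j) * fderiv ℝ φ x (EuclideanSpace.single i 1) := by
  have hdφ : ContDiff ℝ ∞ (fderiv ℝ φ) := hφ.fderiv_right (by simp)
  have hs : ∀ v : Vec n, ContDiff ℝ ∞ (fun x => fderiv ℝ φ x v) := fun v =>
    hdφ.clm_apply contDiff_const
  have hcs : ∀ v : Vec n, HasCompactSupport (fun x => fderiv ℝ φ x v) := fun v =>
    hc.fderiv_apply (𝕜 := ℝ) v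
  have hd : ∀ (x v w : Vec n),
      fderiv ℝ (fun x => fderiv ℝ φ x v) x w = fderiv ℝ (fderiv ℝ φ) x w v := by
    intro x v w
    rw [fderiv_clm_apply (hdφ.differentiable (by simp) x) (differentiableAt_const v)]
    simp
  have hsymm : ∀ (x v w : Vec n),
      fderiv ℝ (fun x => fderiv ℝ φ x v) x w = fderiv ℝ (fun x => fderiv ℝ φ x w) x v := by
    intro x v w
    rw [hd, hd]
    exact (hφ.contDiffAt.isSymmSndFDerivAt (by simpa using ENat.LEInfty.out)) w v
  -- Testing with `∂_j φ` and with `∂_i φ` gives the same second derivative of `φ` against `u`.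
  have h1 := h.integral_eq _ (hs (EuclideanSpace.single j 1)) (hcs _) α i
  have h2 := h.integral_eq _ (hs (EuclideanSpace.single i 1)) (hcs _) α j
  simp only [hsymm _ (EuclideanSpace.single j 1) (EuclideanSpace.single i 1)] at h1
  exact neg_injective (h1.symm.trans h2)

theorem ae_ne_zero (hn : 0 < n) : ∀ᵐ ξ : Vec n, ξ ≠ 0 := by
  have : Nonempty (Fin n) := ⟨⟨0, hn⟩⟩
  exact Measure.ae_ne volume 0

/-- The Fourier transform of a curl-free field is pointwise of rank one. -/
theorem IsWeakGradient.ae_fourier_symm {u : Vec n → Vec N}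
    {G : Lp (Mat N n) 2 (volume : Measure (Vec n))} (h : IsWeakGradient u G)
    (α : Fin N) (i j : Fin n) :
    ∀ᵐ ξ : Vec n, (ξ j : ℂ) * (𝓕 (complexComponent (α, i) G) : Lp ℂ 2 (volume : Measure (Vec n))) ξ =
      ξ i * (𝓕 (complexComponent (α, j) G) : Lp ℂ 2 (volume : Measure (Vec n))) ξ := by
  have H := ae_sum_inner_mul_fourier_eq_zero (E := Vec n)
    -- The curl condition is written as a divergence identity for the pair of components `(α, i)`,
    -- `(α, j)` in directions `e_j` and `-e_i`.
    (m := ![EuclideanSpace.single j 1, -EuclideanSpace.single i 1])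
    (h := ![complexComponent (α, i) G, complexComponent (α, j) G]) (by
      intro φ hφ hc
      have hint : ∀ (k l : Fin n), ∫ x, ((fderiv ℝ φ x (EuclideanSpace.single l 1) : ℝ) : ℂ) *
          complexComponent (α, k) G x =
          ((∫ x, G x (α, k) * fderiv ℝ φ x (EuclideanSpace.single l 1) : ℝ) : ℂ) := by
        intro k l
        rw [← integral_complex_ofReal]
        refine integral_congr_ae ?_
        filter_upwards [coeFn_complexComponent (α, k) G] with x hx
        rw [hx]
        push_cast
        ring
      have := h.integral_symm hφ hc α i j
      simp only [Fin.sum_univ_two, Matrix.cons_val_zero, Matrix.cons_val_one, map_neg,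
        Complex.ofReal_neg, neg_mul, integral_neg, hint, this, add_neg_cancel])
  filter_upwards [H] with ξ hξ
  simp only [Fin.sum_univ_two, Matrix.cons_val_zero, Matrix.cons_val_one, inner_neg_right,
    coordinate_inner_single, Complex.ofReal_neg, neg_mul] at hξ
  exact eq_of_sub_eq_zero (by rw [sub_eq_add_neg]; exact hξ)

/-- The a priori estimate `ν(A) ‖Du‖ ≤ ‖A : Du‖` in `L²`. -/
theorem IsWeakGradient.ellipticityConst_mul_norm_le (hn : 0 < n) {A : Mat N n →ₗ[ℝ] Vec N}
    (hA : 0 ≤ ellipticityConst A) {u : Vec n → Vec N}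
    {G : Lp (Mat N n) 2 (volume : Measure (Vec n))} (h : IsWeakGradient u G) :
    ellipticityConst A * ‖G‖ ≤ ‖applyL2 A G‖ := by
  refine le_of_sq_le_sq ?_ (norm_nonneg _)
  rw [mul_pow, norm_sq_eq_integral_fourier, norm_sq_eq_integral_fourier, ← integral_const_mul]
  refine integral_mono_ae ?_ ?_ ?_
  · exact (integrable_finsetSum _ fun i _ =>
      (Lp.memLp _).integrable_norm_pow two_ne_zero).const_mul _
  · exact integrable_finsetSum _ fun i _ => (Lp.memLp _).integrable_norm_pow two_ne_zero
  have h1 : ∀ᵐ ξ : Vec n, ∀ α i j,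
      (ξ j : ℂ) * (𝓕 (complexComponent (α, i) G) : Lp ℂ 2 (volume : Measure (Vec n))) ξ =
      ξ i * (𝓕 (complexComponent (α, j) G) : Lp ℂ 2 (volume : Measure (Vec n))) ξ :=
    ae_all_iff.2 fun α => ae_all_iff.2 fun i => ae_all_iff.2 fun j => h.ae_fourier_symm α i j
  have h2 : ∀ᵐ ξ : Vec n, ∀ β,
      (𝓕 (complexComponent β (applyL2 A G)) : Lp ℂ 2 (volume : Measure (Vec n))) ξ =
      ∑ p, (A (EuclideanSpace.single p 1) β : ℂ) *
        (𝓕 (complexComponent p G) : Lp ℂ 2 (volume : Measure (Vec n))) ξ := by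
    refine ae_all_iff.2 fun β => ?_
    rw [complexComponent_applyL2]
    exact coeFn_fourier_sum_smul _ _
  filter_upwards [ae_ne_zero hn, h1, h2] with ξ hξ h1 h2
  simp only [h2]
  exact ellipticityConst_sq_mul_sum_le hA hξ h1

/-- The Fourier side of the injectivity of the formal adjoint of `u ↦ A : Du`. -/
theorem eq_zero_of_integral_inner_rankOne (hn : 0 < n) {A : Mat N n →ₗ[ℝ] Vec N}
    (hA : 0 < ellipticityConst A) {f : Lp (Vec N) 2 (volume : Measure (Vec n))}
    (hf : ∀ φ : Vec n → ℝ, ContDiff ℝ ∞ φ → HasCompactSupport φ → ∀ α : Fin N,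
      ∑ i, ∫ x, fderiv ℝ φ x (EuclideanSpace.single i 1) *
        ∑ β, A (EuclideanSpace.single (α, i) 1) β * f x β = 0) : f = 0 := by
  have h1 : ∀ᵐ ξ : Vec n, ∀ α, ∑ i, (ξ i : ℂ) * ∑ β, (A (EuclideanSpace.single (α, i) 1) β : ℂ) *
      (𝓕 (complexComponent β f) : Lp ℂ 2 (volume : Measure (Vec n))) ξ = 0 := by
    refine ae_all_iff.2 fun α => ?_
    have H := ae_sum_inner_mul_fourier_eq_zero (E := Vec n)
      (m := fun i : Fin n => EuclideanSpace.single i 1)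
      (h := fun i => ∑ β, (A (EuclideanSpace.single (α, i) 1) β : ℂ) • complexComponent β f) (by
        intro φ hφ hc
        have hint : ∀ i, ∫ x, ((fderiv ℝ φ x (EuclideanSpace.single i 1) : ℝ) : ℂ) *
            (∑ β, (A (EuclideanSpace.single (α, i) 1) β : ℂ) • complexComponent β f :
              Lp ℂ 2 (volume : Measure (Vec n))) x =
            ((∫ x, fderiv ℝ φ x (EuclideanSpace.single i 1) *
              ∑ β, A (EuclideanSpace.single (α, i) 1) β * f x β : ℝ) : ℂ) := by
          intro i
          rw [← integral_complex_ofReal]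
          refine integral_congr_ae ?_
          filter_upwards [Lp.coeFn_finsetSum Finset.univ fun β =>
              (A (EuclideanSpace.single (α, i) 1) β : ℂ) • complexComponent β f,
            ae_all_iff.2 fun β => coeFn_complexComponent β f,
            ae_all_iff.2 fun β => Lp.coeFn_smul (A (EuclideanSpace.single (α, i) 1) β : ℂ)
              (complexComponent β f)] with x h3 h4 h5
          rw [h3]
          simp only [Finset.sum_apply, h5, Pi.smul_apply, h4, smul_eq_mul]
          push_cast
          rfl
        simp only [hint]
        exact_mod_cast hf φ hφ hc α)
    have H2 : ∀ᵐ ξ : Vec n, ∀ i,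
        (𝓕 (∑ β, (A (EuclideanSpace.single (α, i) 1) β : ℂ) • complexComponent β f) :
          Lp ℂ 2 (volume : Measure (Vec n))) ξ =
        ∑ β, (A (EuclideanSpace.single (α, i) 1) β : ℂ) *
          (𝓕 (complexComponent β f) : Lp ℂ 2 (volume : Measure (Vec n))) ξ :=
      ae_all_iff.2 fun i => coeFn_fourier_sum_smul _ _
    filter_upwards [H, H2] with ξ hξ h2
    simpa only [h2, coordinate_inner_single] using hξ
  have h2 : ‖f‖ ^ 2 = 0 := by
    rw [norm_sq_eq_integral_fourier]
    refine integral_eq_zero_of_ae ?_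
    filter_upwards [ae_ne_zero hn, h1] with ξ hξ h1
    set z : Fin N → ℂ := fun β => (𝓕 (complexComponent β f) : Lp ℂ 2 (volume : Measure (Vec n))) ξ
      with hz
    have key : ∀ w : Vec N, (∀ α, ∑ i, ξ i * ∑ β, A (EuclideanSpace.single (α, i) 1) β * w β = 0) →
        w = 0 := by
      intro w hw
      refine eq_zero_of_forall_inner_rankOne hA hξ fun α => ?_
      rw [← hw α, rankOne_single_left, map_sum, inner_sum]
      refine Finset.sum_congr rfl fun i _ => ?_
      rw [map_smul, inner_smul_right, PiLp.inner_apply]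
      simp
    have hre := key (WithLp.toLp 2 fun β => (z β).re) fun α => by
      simpa using congrArg Complex.re (h1 α)
    have him := key (WithLp.toLp 2 fun β => (z β).im) fun α => by
      simpa using congrArg Complex.im (h1 α)
    refine Finset.sum_eq_zero fun β _ => ?_
    have : z β = 0 := Complex.ext (congrArg (fun w : Vec N => w β) hre)
      (congrArg (fun w : Vec N => w β) him)
    change ‖z β‖ ^ 2 = 0
    simp [this]
  exact norm_eq_zero.1 (pow_eq_zero_iff two_ne_zero |>.1 h2)

end Estimate

/-! ### A function in `Lᵖ` with zero weak derivatives vanishes. -/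

section Liouville

variable {E : Type*} [NormedAddCommGroup E] [InnerProductSpace ℝ E] [FiniteDimensional ℝ E]
  [MeasurableSpace E] [BorelSpace E]

open scoped Convolution in
/-- A function in `Lᵖ`, `1 ≤ p < ∞`, with vanishing weak derivatives is zero. -/
theorem ae_eq_zero_of_integral_mul_fderiv_eq_zero [Nontrivial E] {p : ℝ≥0∞} (hp : 1 ≤ p)
    (hp' : p ≠ ⊤) {w : E → ℝ} (hw : MemLp w p volume)
    (h : ∀ φ : E → ℝ, ContDiff ℝ ∞ φ → HasCompactSupport φ → ∀ v : E,
      ∫ x, w x * fderiv ℝ φ x v = 0) : ∀ᵐ x, w x = 0 := by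
  have hwl : LocallyIntegrable w volume := hw.locallyIntegrable hp
  have hneg : ∀ (φ : E → ℝ) (y : E), HasCompactSupport φ → HasCompactSupport fun x => φ (y - x) :=
    fun φ y hφ => hφ.comp_homeomorph (Homeomorph.subLeft y)
  let L := ContinuousLinearMap.mul ℝ ℝ
  have hconv : ∀ (f φ : E → ℝ) (y : E), (f ⋆[L] φ) y = ∫ x, f x * φ (y - x) := fun f φ y => rfl
  have key : ∀ φ : E → ℝ, ContDiff ℝ ∞ φ → HasCompactSupport φ → ∫ x, w x * φ (0 - x) = 0 := by
    intro φ hφ hφc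
    have hφ1 : ContDiff ℝ 1 φ := hφ.of_le (by simp)
    have hd := hφc.hasFDerivAt_convolution_right (μ := volume) L hwl hφ1
    -- The derivative of `w ⋆ φ` at `y` pairs `w` with a derivative of the test function `φ (y -
    -- ·)`, up to sign, so it vanishes.
    have hconst : ∀ y, (w ⋆[L] φ) y = (w ⋆[L] φ) 0 := by
      refine fun y => is_const_of_fderiv_eq_zero (𝕜 := ℝ) (fun y => (hd y).differentiableAt)
        (fun y => ?_) y 0
      rw [(hd y).fderiv]
      ext v
      rw [convolution_precompR_apply L hwl (hφc.fderiv (𝕜 := ℝ)) (hφ.continuous_fderiv (by simp)),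
        hconv]
      have h1 := h (fun x => φ (y - x)) (hφ.comp (contDiff_const.sub contDiff_id)) (hneg φ y hφc) v
      have h2 : ∀ x, fderiv ℝ (fun x => φ (y - x)) x v = -fderiv ℝ φ (y - x) v := by
        intro x
        have h3 : HasFDerivAt (fun x => φ (y - x))
            ((fderiv ℝ φ (y - x)).comp (-ContinuousLinearMap.id ℝ E)) x :=
          (hφ.differentiable (by simp) _).hasFDerivAt.comp x ((hasFDerivAt_id x).const_sub y)
        rw [h3.fderiv]
        simp
      simpa [h2, integral_neg] using h1
    have : ENNReal.HolderConjugate p (1 - p⁻¹)⁻¹ := ENNReal.HolderConjugate.inv_one_sub_inv' hp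
    set q := (1 - p⁻¹)⁻¹
    have hφq : MemLp φ q volume := hφ.continuous.memLp_of_hasCompactSupport hφc
    -- The constant `w ⋆ φ` is evaluated where it is small: for a compactly supported `g` close to
    -- `w` in `Lᵖ`, `g ⋆ φ` has compact support, hence a zero `y` in the noncompact space `E`. There
    -- the constant equals `((w - g) ⋆ φ) y`, which Hölder's inequality controls.
    have hbound : ∀ ε : ℝ≥0∞, ε ≠ 0 → ‖(w ⋆[L] φ) 0‖ₑ ≤ ε * eLpNorm φ q volume := by
      intro ε hε
      obtain ⟨g, hgc, hgε, hg, hgm⟩ := hw.exists_hasCompactSupport_eLpNorm_sub_le hp' hε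
      obtain ⟨y, hy⟩ : ∃ y, (g ⋆[L] φ) y = 0 := by
        by_contra! hne
        have hcs : HasCompactSupport (g ⋆[L] φ) := hgc.convolution L hφc
        have huniv : tsupport (g ⋆[L] φ) = Set.univ :=
          Set.eq_univ_of_forall fun y => subset_tsupport _ (hne y)
        have hcs' : IsCompact (tsupport (g ⋆[L] φ)) := hcs
        rw [huniv] at hcs'
        have : NoncompactSpace E := NormedSpace.noncompactSpace ℝ E
        exact noncompact_univ E hcs'
      have hφy : Continuous fun x => φ (y - x) := hφ.continuous.comp (by fun_prop)
      have e1 : (w ⋆[L] φ) 0 = ∫ x, ((w - g) • fun x => φ (y - x)) x := by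
        rw [← hconst y, ← sub_zero ((w ⋆[L] φ) y), ← hy, hconv, hconv, ← integral_sub]
        · simp [sub_mul]
        · exact hφc.convolutionExists_right L hwl hφ.continuous y
        · exact hφc.convolutionExists_right L (hgm.locallyIntegrable hp) hφ.continuous y
      have e2 : eLpNorm (fun x => φ (y - x)) q volume = eLpNorm φ q volume :=
        eLpNorm_comp_measurePreserving hφ.continuous.aestronglyMeasurable
          (Measure.measurePreserving_sub_left volume y)
      calc ‖(w ⋆[L] φ) 0‖ₑ ≤ eLpNorm ((w - g) • fun x => φ (y - x)) 1 volume := by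
            rw [e1, eLpNorm_one_eq_lintegral_enorm]
            exact enorm_integral_le_lintegral_enorm _
        _ ≤ eLpNorm (w - g) p volume * eLpNorm (fun x => φ (y - x)) q volume :=
            eLpNorm_smul_le_mul_eLpNorm hφy.aestronglyMeasurable (hw.sub hgm).aestronglyMeasurable
        _ ≤ ε * eLpNorm φ q volume := by
            rw [e2]
            gcongr
    have hlim : Tendsto (fun ε : ℝ≥0∞ => ε * eLpNorm φ q volume) (𝓝[≠] 0) (𝓝 0) := by
      have := (ENNReal.continuous_mul_const hφq.eLpNorm_ne_top).tendsto 0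
      rw [zero_mul] at this
      exact this.mono_left nhdsWithin_le_nhds
    have h0 : ‖(w ⋆[L] φ) 0‖ₑ ≤ 0 := by
      refine ge_of_tendsto hlim ?_
      filter_upwards [self_mem_nhdsWithin] with ε hε
      exact hbound ε hε
    simpa [hconv] using h0
  apply ae_eq_zero_of_integral_contDiff_smul_eq_zero hwl
  intro φ hφ hφc
  have := key (fun x => φ (0 - x)) (hφ.comp (contDiff_const.sub contDiff_id)) (hneg φ 0 hφc)
  simpa [mul_comm] using this

end Liouville

/-! ### Algebra and closedness of weak gradients. -/

section WeakGradient

variable {N n : ℕ}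

theorem locallyIntegrable_coord {X ι : Type*} [Fintype ι] [TopologicalSpace X] [MeasurableSpace X]
    {μ : Measure X} {G : X → EuclideanSpace ℝ ι} (h : LocallyIntegrable G μ) (i : ι) :
    LocallyIntegrable (fun x => G x i) μ := by
  intro x
  obtain ⟨s, hs, h⟩ := h x
  exact ⟨s, hs, (EuclideanSpace.proj (𝕜 := ℝ) i).integrable_comp h⟩

theorem integrable_coord_mul {X ι : Type*} [Fintype ι] [TopologicalSpace X] [T2Space X]
    [MeasurableSpace X] [BorelSpace X]
    {μ : Measure X} {G : X → EuclideanSpace ℝ ι} (h : LocallyIntegrable G μ) (i : ι) {φ : X → ℝ}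
    (hφ : Continuous φ) (hc : HasCompactSupport φ) : Integrable (fun x => G x i * φ x) μ :=
  (locallyIntegrable_coord h i).integrable_smul_right_of_hasCompactSupport hφ hc

theorem IsWeakGradient.sub {u v : Vec n → Vec N} {G H : Vec n → Mat N n}
    (hu : IsWeakGradient u G) (hv : IsWeakGradient v H) : IsWeakGradient (u - v) (G - H) where
  locallyIntegrable := hu.locallyIntegrable.sub hv.locallyIntegrable
  locallyIntegrable_grad := hu.locallyIntegrable_grad.sub hv.locallyIntegrable_grad
  integral_eq φ hφ hc α i := by
    have hd : Continuous fun x => fderiv ℝ φ x (EuclideanSpace.single i 1) :=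
      (hφ.continuous_fderiv (by simp)).clm_apply continuous_const
    have hdc := hc.fderiv_apply (𝕜 := ℝ) (EuclideanSpace.single i 1)
    simp only [Pi.sub_apply, PiLp.sub_apply, sub_mul]
    rw [integral_sub (integrable_coord_mul hu.locallyIntegrable α hd hdc)
      (integrable_coord_mul hv.locallyIntegrable α hd hdc),
      integral_sub (integrable_coord_mul hu.locallyIntegrable_grad (α, i) hφ.continuous hc)
      (integrable_coord_mul hv.locallyIntegrable_grad (α, i) hφ.continuous hc),
      hu.integral_eq φ hφ hc, hv.integral_eq φ hφ hc]
    ring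

theorem IsWeakGradient.congr {u v : Vec n → Vec N} {G H : Vec n → Mat N n}
    (hu : IsWeakGradient u G) (huv : u =ᵐ[volume] v) (hGH : G =ᵐ[volume] H) :
    IsWeakGradient v H where
  locallyIntegrable := hu.locallyIntegrable.congr huv
  locallyIntegrable_grad := hu.locallyIntegrable_grad.congr hGH
  integral_eq φ hφ hc α i := by
    have h1 : ∫ x, v x α * fderiv ℝ φ x (EuclideanSpace.single i 1) =
        ∫ x, u x α * fderiv ℝ φ x (EuclideanSpace.single i 1) :=
      integral_congr_ae (by filter_upwards [huv] with x hx; rw [hx])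
    have h2 : ∫ x, H x (α, i) * φ x = ∫ x, G x (α, i) * φ x :=
      integral_congr_ae (by filter_upwards [hGH] with x hx; rw [hx])
    rw [h1, h2, hu.integral_eq φ hφ hc]

/-- A map in `Lᵖ`, `1 ≤ p < ∞`, whose weak gradient vanishes is zero. -/
theorem IsWeakGradient.ae_eq_zero (hn : 0 < n) {p : ℝ≥0∞} (hp : 1 ≤ p) (hp' : p ≠ ⊤)
    {u : Vec n → Vec N} (hu : MemLp u p volume) (h : IsWeakGradient u 0) :
    u =ᵐ[volume] 0 := by
  have : Nonempty (Fin n) := ⟨⟨0, hn⟩⟩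
  have key : ∀ α, ∀ᵐ x, u x α = 0 := by
    intro α
    refine ae_eq_zero_of_integral_mul_fderiv_eq_zero hp hp'
      ((EuclideanSpace.proj (𝕜 := ℝ) α).comp_memLp' hu) fun φ hφ hc v => ?_
    have hv : v = ∑ i, v i • EuclideanSpace.single i (1 : ℝ) := by
      ext i
      simp [Finset.sum_apply, Pi.single_apply]
    have h0 : ∀ i, ∫ x, u x α * fderiv ℝ φ x (EuclideanSpace.single i 1) = 0 := fun i => by
      simpa using h.integral_eq φ hφ hc α i
    have hd : ∀ x, u x α * fderiv ℝ φ x v =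
        ∑ i, v i * (u x α * fderiv ℝ φ x (EuclideanSpace.single i 1)) := by
      intro x
      conv_lhs => rw [hv]
      rw [map_sum, Finset.mul_sum]
      refine Finset.sum_congr rfl fun i _ => ?_
      rw [map_smul, smul_eq_mul]
      ring
    change ∫ x, u x α * fderiv ℝ φ x v = 0
    simp only [hd]
    rw [integral_finsetSum]
    · simp [integral_const_mul, h0]
    · intro i _
      exact (integrable_coord_mul h.locallyIntegrable α
        ((hφ.continuous_fderiv (by simp)).clm_apply continuous_const)
        (hc.fderiv_apply (𝕜 := ℝ) _)).const_mul _
  filter_upwards [ae_all_iff.2 key] with x hx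
  exact PiLp.ext hx

/-- Pairing a component with a fixed test function is continuous on `Lᵖ`. -/
theorem tendsto_integral_coord_mul {ι : Type*} [Fintype ι] {p : ℝ≥0∞} [Fact (1 ≤ p)]
    {u : ℕ → Lp (EuclideanSpace ℝ ι) p (volume : Measure (Vec n))}
    {v : Lp (EuclideanSpace ℝ ι) p (volume : Measure (Vec n))} (h : Tendsto u atTop (𝓝 v)) (i : ι)
    {φ : Vec n → ℝ} (hφ : Continuous φ) (hc : HasCompactSupport φ) :
    Tendsto (fun k => ∫ x, u k x i * φ x) atTop (𝓝 (∫ x, v x i * φ x)) := by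
  have : ENNReal.HolderConjugate p (1 - p⁻¹)⁻¹ :=
    ENNReal.HolderConjugate.inv_one_sub_inv' Fact.out
  have : Fact (1 ≤ (1 - p⁻¹)⁻¹) := by simp [fact_iff]
  have hφm : MemLp φ (1 - p⁻¹)⁻¹ (volume : Measure (Vec n)) := hφ.memLp_of_hasCompactSupport hc
  let B : EuclideanSpace ℝ ι →L[ℝ] ℝ →L[ℝ] ℝ :=
    (ContinuousLinearMap.mul ℝ ℝ).comp (EuclideanSpace.proj i)
  have hB : ∀ w : Lp (EuclideanSpace ℝ ι) p (volume : Measure (Vec n)),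
      (B.lpPairing volume p (1 - p⁻¹)⁻¹).flip (hφm.toLp φ) w = ∫ x, w x i * φ x := by
    intro w
    rw [ContinuousLinearMap.flip_apply, ContinuousLinearMap.lpPairing_eq_integral]
    refine integral_congr_ae ?_
    filter_upwards [hφm.coeFn_toLp] with x hx
    simp [B, hx]
  have := (((B.lpPairing volume p (1 - p⁻¹)⁻¹).flip (hφm.toLp φ)).continuous.tendsto v).comp h
  simpa only [Function.comp_def, hB] using this

/-- Both sides of the integration by parts formula are continuous in `u` and `G` for a fixed test
function. -/
theorem IsWeakGradient.of_tendsto {p : ℝ≥0∞} [Fact (1 ≤ p)]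
    {u : ℕ → Lp (Vec N) p (volume : Measure (Vec n))} {v : Lp (Vec N) p (volume : Measure (Vec n))}
    {G : ℕ → Lp (Mat N n) 2 (volume : Measure (Vec n))}
    {H : Lp (Mat N n) 2 (volume : Measure (Vec n))}
    (h : ∀ k, IsWeakGradient (u k) (G k)) (hu : Tendsto u atTop (𝓝 v))
    (hG : Tendsto G atTop (𝓝 H)) : IsWeakGradient v H where
  locallyIntegrable := (Lp.memLp v).locallyIntegrable Fact.out
  locallyIntegrable_grad := (Lp.memLp H).locallyIntegrable one_le_two
  integral_eq φ hφ hc α i := by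
    refine tendsto_nhds_unique (tendsto_integral_coord_mul hu α
      ((hφ.continuous_fderiv (by simp)).clm_apply continuous_const)
      (hc.fderiv_apply (𝕜 := ℝ) (EuclideanSpace.single i 1))) ?_
    simp only [(h _).integral_eq φ hφ hc]
    exact (tendsto_integral_coord_mul hG (α, i) hφ.continuous hc).neg

end WeakGradient

/-! ### Gradients of test functions, Sobolev potentials and the linear system. -/

section TestGradients

variable {N n : ℕ}

/-- The classical gradient matrix `(D_i φ_α)_{αi}`. -/
def gradMatrix (φ : Vec n → Vec N) (x : Vec n) : Mat N n :=
  WithLp.toLp 2 fun p => fderiv ℝ φ x (EuclideanSpace.single p.2 1) p.1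

theorem gradMatrix_apply (φ : Vec n → Vec N) (x : Vec n) (α : Fin N) (i : Fin n) :
    gradMatrix φ x (α, i) = fderiv ℝ φ x (EuclideanSpace.single i 1) α := rfl

theorem continuous_gradMatrix {φ : Vec n → Vec N} (hφ : ContDiff ℝ ∞ φ) :
    Continuous (gradMatrix φ) := by
  refine (PiLp.continuous_toLp 2 _).comp (continuous_pi fun p => ?_)
  exact (EuclideanSpace.proj (𝕜 := ℝ) p.1).continuous.comp
    ((hφ.continuous_fderiv (by simp)).clm_apply continuous_const)

theorem hasCompactSupport_gradMatrix {φ : Vec n → Vec N} (hφ : HasCompactSupport φ) :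
    HasCompactSupport (gradMatrix φ) :=
  (hφ.fderiv (𝕜 := ℝ)).comp_left
    (g := fun T : Vec n →L[ℝ] Vec N =>
      (WithLp.toLp 2 fun p => T (EuclideanSpace.single p.2 1) p.1 : Mat N n)) (by ext p; simp)

theorem gradMatrix_add {φ ψ : Vec n → Vec N} (hφ : ContDiff ℝ ∞ φ) (hψ : ContDiff ℝ ∞ ψ) :
    gradMatrix (φ + ψ) = gradMatrix φ + gradMatrix ψ := by
  ext x p
  simp [gradMatrix, fderiv_add (hφ.differentiable (by simp) x) (hψ.differentiable (by simp) x)]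

theorem gradMatrix_sub {φ ψ : Vec n → Vec N} (hφ : ContDiff ℝ ∞ φ) (hψ : ContDiff ℝ ∞ ψ) :
    gradMatrix (φ - ψ) = gradMatrix φ - gradMatrix ψ := by
  ext x p
  simp [gradMatrix, fderiv_sub (hφ.differentiable (by simp) x) (hψ.differentiable (by simp) x)]

theorem gradMatrix_const_smul {φ : Vec n → Vec N} (hφ : ContDiff ℝ ∞ φ) (c : ℝ) :
    gradMatrix (c • φ) = c • gradMatrix φ := by
  ext x p
  simp [gradMatrix, fderiv_const_smul (hφ.differentiable (by simp) x)]

theorem gradMatrix_smul_single {φ : Vec n → ℝ} (hφ : ContDiff ℝ ∞ φ) (α : Fin N) (x : Vec n) :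
    gradMatrix (fun x => φ x • EuclideanSpace.single α (1 : ℝ)) x =
      ∑ i, fderiv ℝ φ x (EuclideanSpace.single i 1) • EuclideanSpace.single (α, i) (1 : ℝ) := by
  have h : HasFDerivAt (fun x => φ x • EuclideanSpace.single α (1 : ℝ))
      ((fderiv ℝ φ x).smulRight (EuclideanSpace.single α (1 : ℝ))) x :=
    (hφ.differentiable (by simp) x).hasFDerivAt.smul_const _
  rw [← rankOne_single_left α (WithLp.toLp 2 fun i => fderiv ℝ φ x (EuclideanSpace.single i 1))]
  ext ⟨β, j⟩
  rw [gradMatrix_apply, h.fderiv]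
  simp [rankOne, mul_comm]

/-- The gradient matrix is a weak gradient. -/
theorem isWeakGradient_gradMatrix {φ : Vec n → Vec N} (hφ : ContDiff ℝ ∞ φ) :
    IsWeakGradient φ (gradMatrix φ) where
  locallyIntegrable := hφ.continuous.locallyIntegrable
  locallyIntegrable_grad := (continuous_gradMatrix hφ).locallyIntegrable
  integral_eq ψ hψ hc α i := by
    have hd : ∀ x, fderiv ℝ (fun x => φ x α) x (EuclideanSpace.single i 1) =
        gradMatrix φ x (α, i) := by
      intro x
      have : HasFDerivAt (fun x => φ x α)
          ((EuclideanSpace.proj (𝕜 := ℝ) α : Vec N →L[ℝ] ℝ).comp (fderiv ℝ φ x)) x :=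
        (EuclideanSpace.proj (𝕜 := ℝ) α : Vec N →L[ℝ] ℝ).hasFDerivAt.comp x
          (hφ.differentiable (by simp) x).hasFDerivAt
      rw [this.fderiv]
      rfl
    have hφα : ContDiff ℝ ∞ (fun x => φ x α) :=
      (EuclideanSpace.proj (𝕜 := ℝ) α : Vec N →L[ℝ] ℝ).contDiff.comp hφ
    rw [integral_mul_fderiv_eq_neg_fderiv_mul_of_integrable]
    · simp only [hd]
    · simp only [hd]
      exact integrable_coord_mul (continuous_gradMatrix hφ).locallyIntegrable _ hψ.continuous hc
    · exact integrable_coord_mul hφ.continuous.locallyIntegrable α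
        ((hψ.continuous_fderiv (by simp)).clm_apply continuous_const) (hc.fderiv_apply (𝕜 := ℝ) _)
    · exact integrable_coord_mul hφ.continuous.locallyIntegrable α hψ.continuous hc
    · exact fun x _ => hφα.differentiable (by simp) x
    · exact fun x _ => hψ.differentiable (by simp) x

/-- The derivative is a fixed linear function of the gradient matrix. This passes from the operator
norm in the Sobolev inequality to the Frobenius norm. -/
theorem exists_norm_fderiv_le_gradMatrix (N n : ℕ) : ∃ C : NNReal,
    ∀ (φ : Vec n → Vec N) (x : Vec n), ‖fderiv ℝ φ x‖₊ ≤ C * ‖gradMatrix φ x‖₊ := by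
  let T : Mat N n →ₗ[ℝ] (Vec n →L[ℝ] Vec N) := ∑ p : Fin N × Fin n,
    (EuclideanSpace.proj (𝕜 := ℝ) p : Mat N n →L[ℝ] ℝ).toLinearMap.smulRight
      ((EuclideanSpace.proj (𝕜 := ℝ) p.2 : Vec n →L[ℝ] ℝ).smulRight
        (EuclideanSpace.single p.1 (1 : ℝ)))
  refine ⟨‖T.toContinuousLinearMap‖₊, fun φ x => ?_⟩
  have hT : T (gradMatrix φ x) = fderiv ℝ φ x := by
    ext v α
    have hv : v = ∑ i, v i • EuclideanSpace.single i (1 : ℝ) := by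
      ext i
      simp [Finset.sum_apply, Pi.single_apply]
    conv_rhs => rw [hv]
    simp only [T, LinearMap.sum_apply, LinearMap.smulRight_apply, ContinuousLinearMap.coe_coe,
      PiLp.proj_apply, gradMatrix, sum_apply, smul_apply,
      ContinuousLinearMap.smulRight_apply, map_sum, map_smul, WithLp.ofLp_sum, Finset.sum_apply,
      PiLp.smul_apply, PiLp.single_apply, smul_eq_mul, Fintype.sum_prod_type, mul_ite, mul_one,
      mul_zero]
    rw [Finset.sum_comm]
    simp [mul_comm]
  rw [← hT]
  exact T.toContinuousLinearMap.le_opNNNorm _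

/-- The Sobolev inequality for test functions. -/
theorem exists_sobolev_const (N : ℕ) (hn : 3 ≤ n) : ∃ C : NNReal,
    ∀ φ : Vec n → Vec N, ContDiff ℝ ∞ φ → HasCompactSupport φ →
      eLpNorm φ (sobolevExp n) volume ≤ C * eLpNorm (gradMatrix φ) 2 volume := by
  obtain ⟨C, hC⟩ := exists_norm_fderiv_le_gradMatrix N n
  refine ⟨SNormLESNormFDerivOfEqConst (Vec N) (volume : Measure (Vec n)) (2 : NNReal) * C,
    fun φ hφ hc => ?_⟩
  have hn' : (3 : ℝ) ≤ n := by exact_mod_cast hn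
  have h1 := eLpNorm_le_eLpNorm_fderiv_of_eq (volume : Measure (Vec n)) (u := φ)
    (p := 2) (p' := (2 * (n : ℝ) / ((n : ℝ) - 2)).toNNReal) (hφ.of_le (by simp)) hc
    one_le_two (by simp; omega) (by
      have hn2 : (0 : ℝ) < (n : ℝ) - 2 := by linarith
      rw [Real.coe_toNNReal _ (by positivity)]
      simp only [finrank_euclideanSpace, Fintype.card_fin, NNReal.coe_inv, NNReal.coe_ofNat]
      field_simp)
  refine h1.trans ?_
  have h2 := eLpNorm_le_nnreal_smul_eLpNorm_of_ae_le_mul (μ := volume)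
    (ae_of_all _ fun x => hC φ x) 2
  rw [ENNReal.smul_def, smul_eq_mul] at h2
  rw [ENNReal.coe_mul, mul_assoc]
  exact mul_le_mul_right h2 _

variable (N n) in
/-- The subspace of `L²` of gradients of test functions. -/
def testGradients : Submodule ℝ (Lp (Mat N n) 2 (volume : Measure (Vec n))) where
  carrier := {G | ∃ φ : Vec n → Vec N, ContDiff ℝ ∞ φ ∧ HasCompactSupport φ ∧
    G =ᵐ[volume] gradMatrix φ}
  add_mem' := by
    rintro G H ⟨φ, hφ, hφc, hG⟩ ⟨ψ, hψ, hψc, hH⟩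
    refine ⟨φ + ψ, hφ.add hψ, hφc.add hψc, ?_⟩
    rw [gradMatrix_add hφ hψ]
    exact (Lp.coeFn_add G H).trans (hG.add hH)
  zero_mem' := by
    refine ⟨0, contDiff_const, HasCompactSupport.zero, ?_⟩
    filter_upwards [Lp.coeFn_zero (Mat N n) 2 (volume : Measure (Vec n))] with x hx
    rw [hx]
    ext p
    simp [gradMatrix]
  smul_mem' := by
    rintro c G ⟨φ, hφ, hφc, hG⟩
    refine ⟨c • φ, hφ.const_smul c, hφc.smul_left (f := fun _ => c), ?_⟩
    rw [gradMatrix_const_smul hφ]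
    exact (Lp.coeFn_smul c G).trans (hG.const_smul c)

theorem one_le_sobolevExp (hn : 3 ≤ n) : 1 ≤ sobolevExp n := by
  have hn' : (3 : ℝ) ≤ n := by exact_mod_cast hn
  rw [sobolevExp, ENNReal.one_le_ofReal, le_div_iff₀ (by linarith)]
  linarith

theorem sobolevExp_ne_top (n : ℕ) : sobolevExp n ≠ ⊤ := ENNReal.ofReal_ne_top

/-- Limits of gradients of test functions are gradients of functions in `L^{2*}`, with the Sobolev
inequality. -/
theorem exists_potential (N : ℕ) (hn : 3 ≤ n) : ∃ C : ℝ, 0 ≤ C ∧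
    ∀ G ∈ (testGradients N n).topologicalClosure,
      ∃ u : Lp (Vec N) (sobolevExp n) (volume : Measure (Vec n)),
        IsWeakGradient u G ∧ ‖u‖ ≤ C * ‖G‖ := by
  have : Fact (1 ≤ sobolevExp n) := ⟨one_le_sobolevExp hn⟩
  obtain ⟨C, hC⟩ := exists_sobolev_const N hn
  have key : ∀ (u : Lp (Vec N) (sobolevExp n) (volume : Measure (Vec n)))
      (G : Lp (Mat N n) 2 (volume : Measure (Vec n))) (φ : Vec n → Vec N), ContDiff ℝ ∞ φ →
      HasCompactSupport φ → u =ᵐ[volume] φ → G =ᵐ[volume] gradMatrix φ → ‖u‖ ≤ C * ‖G‖ := by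
    intro u G φ hφ hc hu hG
    have h := hC φ hφ hc
    rw [← eLpNorm_congr_ae hu, ← eLpNorm_congr_ae hG] at h
    have h' := ENNReal.toReal_mono (ENNReal.mul_ne_top ENNReal.coe_ne_top (Lp.eLpNorm_ne_top G)) h
    simpa [Lp.norm_def] using h'
  refine ⟨C, C.2, fun G hG => ?_⟩
  obtain ⟨g, hg, hlim⟩ := mem_closure_iff_seq_limit.1 hG
  choose φ hφ hc hgφ using hg
  have hm : ∀ k, MemLp (φ k) (sobolevExp n) volume := fun k =>
    (hφ k).continuous.memLp_of_hasCompactSupport (hc k)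
  let u : ℕ → Lp (Vec N) (sobolevExp n) (volume : Measure (Vec n)) := fun k => (hm k).toLp
  have hu : ∀ k, u k =ᵐ[volume] φ k := fun k => (hm k).coeFn_toLp
  -- Sobolev's inequality for differences makes the potentials Cauchy in `L^{2*}` as soon as their
  -- gradients converge in `L²`.
  have hdiff : ∀ k l, ‖u k - u l‖ ≤ C * ‖g k - g l‖ := by
    intro k l
    refine key _ _ (φ k - φ l) ((hφ k).sub (hφ l)) ((hc k).sub (hc l)) ?_ ?_
    · exact (Lp.coeFn_sub (u k) (u l)).trans ((hu k).sub (hu l))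
    · rw [gradMatrix_sub (hφ k) (hφ l)]
      exact (Lp.coeFn_sub (g k) (g l)).trans ((hgφ k).sub (hgφ l))
  have hcauchy : CauchySeq u := by
    rw [cauchySeq_iff_tendsto_dist_atTop_0]
    have h1 := (cauchySeq_iff_tendsto_dist_atTop_0.1 hlim.cauchySeq).const_mul (C : ℝ)
    rw [mul_zero] at h1
    refine squeeze_zero (fun _ => dist_nonneg) (fun k => ?_) h1
    rw [dist_eq_norm, dist_eq_norm]
    exact hdiff _ _
  obtain ⟨v, hv⟩ := cauchySeq_tendsto_of_complete hcauchy
  refine ⟨v, IsWeakGradient.of_tendsto (fun k =>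
    (isWeakGradient_gradMatrix (hφ k)).congr (hu k).symm (hgφ k).symm) hv hlim, ?_⟩
  exact le_of_tendsto_of_tendsto' hv.norm (hlim.norm.const_mul _)
    fun k => key _ _ _ (hφ k) (hc k) (hu k) (hgφ k)

/-- The linear system `A : Du = f` is solvable for every `f ∈ L²`. -/
theorem exists_applyL2_eq (hn : 3 ≤ n) {A : Mat N n →ₗ[ℝ] Vec N} (hA : 0 < ellipticityConst A)
    (f : Lp (Vec N) 2 (volume : Measure (Vec n))) :
    ∃ G ∈ (testGradients N n).topologicalClosure, applyL2 A G = f := by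
  have hn0 : 0 < n := by omega
  obtain ⟨C, -, hC⟩ := exists_potential N hn
  set X := (testGradients N n).topologicalClosure with hX
  have : CompleteSpace X := (testGradients N n).isClosed_topologicalClosure.completeSpace_coe
  let L : X →L[ℝ] Lp (Vec N) 2 (volume : Measure (Vec n)) := (applyL2 A).comp X.subtypeL
  -- Every element of `X` has a potential, so it is a weak gradient and the a priori estimate
  -- applies; the range of `L` is therefore closed.
  have hL : AntilipschitzWith (Real.toNNReal (ellipticityConst A)⁻¹) L := by
    refine L.antilipschitz_of_bound fun G => ?_
    obtain ⟨u, hu, -⟩ := hC G G.2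
    have h := hu.ellipticityConst_mul_norm_le hn0 hA.le
    rw [Real.coe_toNNReal _ (inv_nonneg.2 hA.le), inv_mul_eq_div, le_div_iff₀ hA, mul_comm]
    exact h
  have hclosed : IsClosed (L.range : Set (Lp (Vec N) 2 (volume : Measure (Vec n)))) :=
    hL.isClosed_range L.uniformContinuous
  have htop : L.range = ⊤ := by
    rw [← hclosed.submodule_topologicalClosure_eq, Submodule.topologicalClosure_eq_top_iff,
      Submodule.eq_bot_iff]
    intro h hh
    -- Orthogonality of `h` to the range is tested on the gradients of `φ e_α`.
    refine eq_zero_of_integral_inner_rankOne hn0 hA fun φ hφ hc α => ?_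
    have hψ : ContDiff ℝ ∞ fun x => φ x • (EuclideanSpace.single α (1 : ℝ) : Vec N) :=
      hφ.smul contDiff_const
    have hψc : HasCompactSupport fun x => φ x • (EuclideanSpace.single α (1 : ℝ) : Vec N) :=
      hc.smul_right
    have hm : MemLp (gradMatrix fun x => φ x • (EuclideanSpace.single α (1 : ℝ) : Vec N)) 2
        volume :=
      (continuous_gradMatrix hψ).memLp_of_hasCompactSupport (hasCompactSupport_gradMatrix hψc)
    have hmem : hm.toLp ∈ X := Submodule.le_topologicalClosure _ ⟨_, hψ, hψc, hm.coeFn_toLp⟩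
    have h0 : inner ℝ (applyL2 A hm.toLp) h = 0 := hh _ ⟨⟨_, hmem⟩, rfl⟩
    rw [L2.inner_def] at h0
    rw [← integral_finsetSum, ← h0]
    · refine integral_congr_ae ?_
      filter_upwards [coeFn_applyL2 A hm.toLp, hm.coeFn_toLp] with x h1 h2
      rw [h1, h2, gradMatrix_smul_single hφ, map_sum, sum_inner]
      refine Finset.sum_congr rfl fun i _ => ?_
      rw [map_smul, inner_smul_left, PiLp.inner_apply]
      simp [mul_comm]
    · intro i _
      refine MemLp.integrable_mul (p := 2) (q := 2)
        (Continuous.memLp_of_hasCompactSupport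
        ((hφ.continuous_fderiv (by simp)).clm_apply continuous_const)
        (hc.fderiv_apply (𝕜 := ℝ) _)) ?_
      exact memLp_finsetSum _ fun β _ =>
        ((EuclideanSpace.proj (𝕜 := ℝ) β).comp_memLp' (Lp.memLp h)).const_mul _
  obtain ⟨G, hG⟩ := LinearMap.range_eq_top.1 htop f
  exact ⟨G, G.2, hG⟩

end TestGradients

/-! ### The superposition operator of `F` on `L²`. -/

section Nemytskii

variable {N n : ℕ}

/-- On simple functions the composition is a finite sum of measurable pieces with `P` frozen;
continuity in `P` carries measurability to the pointwise limit. -/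
theorem IsCaratheodory.aestronglyMeasurable_comp {F : Vec n → Mat N n → Vec N}
    (hF : IsCaratheodory F) {g : Vec n → Mat N n} (hg : AEStronglyMeasurable g volume) :
    AEStronglyMeasurable (fun x => F x (g x)) volume := by
  have hsimple : ∀ s : SimpleFunc (Vec n) (Mat N n),
      AEStronglyMeasurable (fun x => F x (s x)) volume := by
    intro s
    have h : (fun x => F x (s x)) =
        fun x => ∑ P ∈ s.range, (s ⁻¹' {P}).indicator (fun x => F x P) x := by
      ext1 x
      rw [Finset.sum_eq_single (s x)]
      · simp
      · intro P _ hP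
        have hx : x ∉ s ⁻¹' {P} := fun hx => hP (Set.mem_singleton_iff.1 hx).symm
        exact Set.indicator_of_notMem hx _
      · exact fun hx => absurd (s.mem_range_self x) hx
    rw [h]
    exact Finset.aestronglyMeasurable_fun_sum _ fun P _ =>
      (hF.measurable P).aestronglyMeasurable.indicator (s.measurableSet_preimage _)
  refine aestronglyMeasurable_of_tendsto_ae atTop
    (f := fun k x => F x (hg.stronglyMeasurable_mk.approx k x)) (fun k => hsimple _) ?_
  filter_upwards [hF.continuous, hg.ae_eq_mk] with x hx hgx
  rw [hgx]
  exact (hx.tendsto _).comp (hg.stronglyMeasurable_mk.tendsto_approx x)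

/-- The supremum over `P` and `Q` lies inside the essential supremum, so a single null set serves
all `P` and `Q`. -/
theorem ae_norm_sub_le_of_deviation_lt {F : Vec n → Mat N n → Vec N} {A : Mat N n →ₗ[ℝ] Vec N}
    (h : deviation F A < ⊤) : ∀ᵐ x : Vec n, ∀ P Q : Mat N n,
      ‖F x (P + Q) - F x P - A Q‖ ≤ (deviation F A).toReal * ‖Q‖ := by
  have hae := ENNReal.ae_le_essSup (μ := (volume : Measure (Vec n)))
    (fun x : Vec n => ⨆ (P : Mat N n) (Q : Mat N n) (_ : Q ≠ 0),
      ENNReal.ofReal (‖F x (P + Q) - F x P - A Q‖ / ‖Q‖))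
  filter_upwards [hae] with x hx P Q
  by_cases hQ : Q = 0
  · simp [hQ]
  have h1 : ENNReal.ofReal (‖F x (P + Q) - F x P - A Q‖ / ‖Q‖) ≤ deviation F A :=
    (le_iSup_of_le P (le_iSup_of_le Q (le_iSup (fun _ : Q ≠ 0 =>
      ENNReal.ofReal (‖F x (P + Q) - F x P - A Q‖ / ‖Q‖)) hQ))).trans hx
  rw [ENNReal.ofReal_le_iff_le_toReal h.ne] at h1
  rwa [div_le_iff₀ (norm_pos_iff.2 hQ)] at h1

/-- The superposition operator of `F` maps `L²` to `L²`. -/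
theorem IsCaratheodory.exists_nemytskii {F : Vec n → Mat N n → Vec N} (hF : IsCaratheodory F)
    (h0 : ∀ᵐ x : Vec n, F x 0 = 0) {A : Mat N n →ₗ[ℝ] Vec N} {κ : ℝ}
    (hκ : ∀ᵐ x : Vec n, ∀ P Q : Mat N n, ‖F x (P + Q) - F x P - A Q‖ ≤ κ * ‖Q‖)
    (G : Lp (Mat N n) 2 (volume : Measure (Vec n))) :
    ∃ f : Lp (Vec N) 2 (volume : Measure (Vec n)), ∀ᵐ x, f x = F x (G x) := by
  have hm : MemLp (fun x => F x (G x) - A (G x)) 2 volume := by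
    refine (Lp.memLp G).of_le_mul (c := κ) ?_ ?_
    · exact (hF.aestronglyMeasurable_comp (Lp.aestronglyMeasurable G)).sub
        (A.toContinuousLinearMap.continuous.comp_aestronglyMeasurable (Lp.aestronglyMeasurable G))
    · filter_upwards [h0, hκ] with x h0 hκ
      simpa [h0] using hκ 0 (G x)
  have hm' : MemLp (fun x => F x (G x)) 2 volume := by
    have := hm.add (A.toContinuousLinearMap.comp_memLp' (Lp.memLp G))
    refine this.ae_eq (ae_of_all _ fun x => ?_)
    simp
  exact ⟨hm'.toLp, hm'.coeFn_toLp⟩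

end Nemytskii

/-! ### Uniqueness, a priori bound and existence for the nonlinear system. -/

section Solutions

variable {N n : ℕ}

/-- `grad` is obtained by choice; uniqueness of weak gradients identifies it with any gradient at
hand. -/
theorem LionsSpace.grad_eq (u : LionsSpace n N) {G : Lp (Mat N n) 2 (volume : Measure (Vec n))}
    (h : IsWeakGradient u.toLp G) : u.grad = G :=
  Lp.ext (u.isWeakGradient_grad.unique h)

theorem LionsSpace.isWeakGradient_sub (u v : LionsSpace n N) :
    IsWeakGradient (u.toLp - v.toLp :
      Lp (Vec N) (sobolevExp n) (volume : Measure (Vec n))) (u.grad - v.grad :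
      Lp (Mat N n) 2 (volume : Measure (Vec n))) :=
  (u.isWeakGradient_grad.sub v.isWeakGradient_grad).congr (Lp.coeFn_sub _ _).symm
    (Lp.coeFn_sub _ _).symm

theorem LionsSpace.ext_grad (hn : 3 ≤ n) {u v : LionsSpace n N} (h : u.grad = v.grad) : u = v := by
  have h1 := u.isWeakGradient_sub v
  rw [h, sub_self] at h1
  have h2 := (h1.congr (EventuallyEq.refl _ _) (Lp.coeFn_zero _ _ _)).ae_eq_zero (by omega)
    (one_le_sobolevExp hn) (sobolevExp_ne_top n) (Lp.memLp _)
  have h3 : u.toLp - v.toLp = 0 := Lp.ext (h2.trans (Lp.coeFn_zero _ _ _).symm)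
  exact Subtype.ext (sub_eq_zero.1 h3)

variable {F : Vec n → Mat N n → Vec N} {A : Mat N n →ₗ[ℝ] Vec N} {κ : ℝ}

/-- For the difference `D` of the two gradients the values of `F` cancel, leaving `|A : D| ≤ κ |D|`
almost everywhere. With `ν(A) ‖D‖ ≤ ‖A : D‖` and `κ < ν(A)` this forces `D = 0`. -/
theorem IsSolution.unique (hn : 3 ≤ n) (hA : 0 ≤ ellipticityConst A) (hκA : κ < ellipticityConst A)
    (hκ : ∀ᵐ x : Vec n, ∀ P Q : Mat N n, ‖F x (P + Q) - F x P - A Q‖ ≤ κ * ‖Q‖)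
    {f : Lp (Vec N) 2 (volume : Measure (Vec n))} {u v : LionsSpace n N}
    (hu : IsSolution F f u) (hv : IsSolution F f v) : u = v := by
  refine LionsSpace.ext_grad hn ?_
  have h1 := (u.isWeakGradient_sub v).ellipticityConst_mul_norm_le (by omega) hA
  have h2 : ‖applyL2 A (u.grad - v.grad)‖ ≤ κ * ‖u.grad - v.grad‖ := by
    refine Lp.norm_le_mul_norm_of_ae_le_mul ?_
    filter_upwards [hκ, hu, hv, coeFn_applyL2 A (u.grad - v.grad), Lp.coeFn_sub u.grad v.grad]
      with x hκ hu hv h3 h4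
    rw [h3, h4]
    have := hκ (v.grad x) (u.grad x - v.grad x)
    rw [add_sub_cancel, hu, hv, sub_self, zero_sub, norm_neg] at this
    exact this
  have h3 : ‖u.grad - v.grad‖ = 0 := by
    by_contra hne
    have hpos : 0 < ‖u.grad - v.grad‖ := lt_of_le_of_ne (norm_nonneg _) (Ne.symm hne)
    have := mul_lt_mul_of_pos_right hκA hpos
    linarith
  exact sub_eq_zero.1 (norm_eq_zero.1 h3)

/-- The argument is that of uniqueness, comparing with the zero matrix, where `F` vanishes. -/
theorem IsSolution.norm_grad_le (hn : 3 ≤ n) (hA : 0 ≤ ellipticityConst A)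
    (h0 : ∀ᵐ x : Vec n, F x 0 = 0)
    (hκ : ∀ᵐ x : Vec n, ∀ P Q : Mat N n, ‖F x (P + Q) - F x P - A Q‖ ≤ κ * ‖Q‖)
    {f : Lp (Vec N) 2 (volume : Measure (Vec n))} {u : LionsSpace n N} (hu : IsSolution F f u) :
    (ellipticityConst A - κ) * ‖u.grad‖ ≤ ‖f‖ := by
  have h1 := u.isWeakGradient_grad.ellipticityConst_mul_norm_le (by omega) hA
  have h2 : ‖f - applyL2 A u.grad‖ ≤ κ * ‖u.grad‖ := by
    refine Lp.norm_le_mul_norm_of_ae_le_mul ?_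
    filter_upwards [hκ, h0, hu, coeFn_applyL2 A u.grad, Lp.coeFn_sub f (applyL2 A u.grad)]
      with x hκ h0 hu h3 h4
    rw [h4, Pi.sub_apply, h3]
    simpa [h0, hu] using hκ 0 (u.grad x)
  have h3 : ‖applyL2 A u.grad‖ ≤ ‖f‖ + ‖f - applyL2 A u.grad‖ := by
    have := norm_sub_le f (f - applyL2 A u.grad)
    rwa [sub_sub_cancel] at this
  linarith

theorem exists_mem_closure_solution (hn : 3 ≤ n) (hF : IsCaratheodory F)
    (h0 : ∀ᵐ x : Vec n, F x 0 = 0) (hA : 0 < ellipticityConst A) (hκ0 : 0 ≤ κ)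
    (hκA : κ < ellipticityConst A)
    (hκ : ∀ᵐ x : Vec n, ∀ P Q : Mat N n, ‖F x (P + Q) - F x P - A Q‖ ≤ κ * ‖Q‖)
    (f : Lp (Vec N) 2 (volume : Measure (Vec n))) :
    ∃ G ∈ (testGradients N n).topologicalClosure, ∀ᵐ x, F x (G x) = f x := by
  obtain ⟨C, -, hC⟩ := exists_potential N hn
  choose Φ hΦ using hF.exists_nemytskii h0 hκ
  choose R hRmem hR using exists_applyL2_eq hn hA
  -- `R` is only a choice of preimages; its Lipschitz bound comes from the a priori estimate for `R
  -- w - R w'`, which is again a weak gradient.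
  have hRle : ∀ w w', ‖R w - R w'‖ ≤ (ellipticityConst A)⁻¹ * ‖w - w'‖ := by
    intro w w'
    obtain ⟨u, hu, -⟩ := hC _ (Submodule.sub_mem _ (hRmem w) (hRmem w'))
    have h := hu.ellipticityConst_mul_norm_le (by omega) hA.le
    rw [map_sub, hR, hR] at h
    rwa [inv_mul_eq_div, le_div_iff₀ hA, mul_comm]
  -- The unknown is `w = A : Du`, free in all of `L²`. Since `A : R w = w`, the bracket is the
  -- perturbation `F - A` at `R w`, which is `κ`-Lipschitz; `T w = w` means `Φ (R w) = f`.
  let T : Lp (Vec N) 2 (volume : Measure (Vec n)) → Lp (Vec N) 2 (volume : Measure (Vec n)) :=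
    fun w => f - (Φ (R w) - w)
  have hT : ContractingWith (Real.toNNReal (κ * (ellipticityConst A)⁻¹)) T := by
    refine ⟨?_, LipschitzWith.of_dist_le_mul fun w w' => ?_⟩
    · rw [Real.toNNReal_lt_one, ← div_eq_mul_inv, div_lt_one hA]
      exact hκA
    rw [Real.coe_toNNReal _ (mul_nonneg hκ0 (inv_nonneg.2 hA.le)), dist_comm, dist_eq_norm,
      dist_eq_norm]
    have h1 : ‖Φ (R w) - Φ (R w') - applyL2 A (R w - R w')‖ ≤ κ * ‖R w - R w'‖ := by
      refine Lp.norm_le_mul_norm_of_ae_le_mul ?_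
      filter_upwards [hκ, hΦ (R w), hΦ (R w'), coeFn_applyL2 A (R w - R w'),
        Lp.coeFn_sub (R w) (R w'), Lp.coeFn_sub (Φ (R w)) (Φ (R w')),
        Lp.coeFn_sub (Φ (R w) - Φ (R w')) (applyL2 A (R w - R w'))]
        with x hκ h1 h2 h3 h4 h5 h6
      rw [h6, Pi.sub_apply, h5, Pi.sub_apply, h3, h4, Pi.sub_apply, h1, h2]
      have := hκ (R w' x) (R w x - R w' x)
      rwa [add_sub_cancel] at this
    rw [map_sub, hR, hR] at h1
    have h2 : T w' - T w = Φ (R w) - Φ (R w') - (w - w') := by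
      simp only [T]
      abel
    rw [h2, mul_assoc]
    exact h1.trans (mul_le_mul_of_nonneg_left (hRle w w') hκ0)
  have hfix : T (hT.fixedPoint T) = hT.fixedPoint T := hT.fixedPoint_isFixedPt
  set w := hT.fixedPoint T
  have hw : Φ (R w) = f := by
    simp only [T] at hfix
    have h2 : f - Φ (R w) = 0 := by
      have := sub_eq_zero.2 hfix
      rw [← this]
      abel
    exact (sub_eq_zero.1 h2).symm
  refine ⟨R w, hRmem w, ?_⟩
  filter_upwards [hΦ (R w)] with x hx
  rw [← hx, hw]

end Solutions

end EllipticSystem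

end

/-! ### Assembly of existence, uniqueness and the norm bound. -/

theorem theorem2 {n N : ℕ} (hn : 3 ≤ n) (hN : 2 ≤ N)
    (F : EllipticSystem.Vec n → EllipticSystem.Mat N n → EllipticSystem.Vec N)
    (hF : EllipticSystem.IsCaratheodory F)
    (hell : EllipticSystem.IsStrictlyElliptic F)
    (h0 : ∀ᵐ x : EllipticSystem.Vec n, F x 0 = 0) :
    ∃ C : ℝ, 0 < C ∧
      ∀ f : Lp (EllipticSystem.Vec N) 2 (volume : Measure (EllipticSystem.Vec n)),
        (∃! u : EllipticSystem.LionsSpace n N, EllipticSystem.IsSolution F f u) ∧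
        ∀ u : EllipticSystem.LionsSpace n N, EllipticSystem.IsSolution F f u →
          ‖u.toLp‖ + ‖u.grad‖ ≤ C * ‖f‖ := by
  open EllipticSystem in
  obtain ⟨A, hdev⟩ := hell
  have hκ := ae_norm_sub_le_of_deviation_lt (hdev.trans ENNReal.ofReal_lt_top)
  have hA : 0 < ellipticityConst A := ENNReal.ofReal_pos.1 (zero_le.trans_lt hdev)
  have hκA : (deviation F A).toReal < ellipticityConst A := ENNReal.toReal_lt_of_lt_ofReal hdev
  obtain ⟨C, hC0, hC⟩ := exists_potential N hn
  have hpos : 0 < ellipticityConst A - (deviation F A).toReal := sub_pos.2 hκA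
  -- `C` is the Sobolev constant bounding `‖u‖` by `‖Du‖`, the `1` accounts for `‖Du‖` itself, and
  -- the denominator comes from `(ν(A) - κ) ‖Du‖ ≤ ‖f‖`.
  refine ⟨(C + 1) / (ellipticityConst A - (deviation F A).toReal), by positivity, fun f => ?_⟩
  obtain ⟨G, hGmem, hG⟩ := exists_mem_closure_solution hn hF h0 hA ENNReal.toReal_nonneg hκA hκ f
  obtain ⟨w, hw, hwC⟩ := hC G hGmem
  let u : LionsSpace n N := ⟨w, G, hw⟩
  have hgrad : u.grad = G := u.grad_eq hw
  have hu : IsSolution F f u := by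
    rw [IsSolution, hgrad]
    exact hG
  have huniq : ∀ v, IsSolution F f v → v = u := fun v hv =>
    IsSolution.unique hn hA.le hκA hκ hv hu
  refine ⟨⟨u, hu, huniq⟩, fun v hv => ?_⟩
  rw [huniq v hv]
  have h1 : ‖u.toLp‖ ≤ C * ‖u.grad‖ := by
    rw [hgrad]
    exact hwC
  have h2 := hu.norm_grad_le hn hA.le h0 hκ
  rw [mul_comm, ← le_div_iff₀ hpos] at h2
  calc ‖u.toLp‖ + ‖u.grad‖ ≤ (C + 1) * ‖u.grad‖ := by linarith
    _ ≤ (C + 1) * (‖f‖ / (ellipticityConst A - (deviation F A).toReal)) := by gcongr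
    _ = _ := by ring
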